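/- Let $G$ be a finite simple graph of order $n$ and size (number of edges) $m$ that is neither complete nor edgeless, and let $c$ be an integer with $4\le c\le n-4$. Let $M_c$ be the number of edges of the subgraph of $G$ induced by a uniformly random set of $c$ vertices, let $\ell(c)$ and $u(c)$ be the minimum and the maximum value of $M_c$, and put $S_1=\mathbb E[M_c]$, $S_2=\tfrac12\mathbb E[M_c(M_c-1)]$, $\sigma^2=2S_2-S_1(S_1-1)$ (the variance of $M_c$). (a) For all integers $\ell_\star\le\ell(c)$ and $u^\star\ge u(c)$ one has $S_1>0$ and $\ell_\star<S_1<u^\star$; $G$ has an induced subgraph of order $c$ with at least $$\left\lceil\max\left\{\frac{2S_2}{S_1}+1,\; S_1+\frac{\sigma^2}{S_1-\ell_\star}\right\}\right\rceil$$ edges, and an induced subgraph of order $c$ with at most $$\left\lfloor S_1-\frac{\sigma^2}{u^\star-S_1}\right\rfloor$$ edges. (b) For $\ell_\star=\ell(c)$, the first bound without rounding is attained, i.e. $u(c)=\max\{2S_2/S_1+1,\,S_1+\sigma^2/(S_1-\ell(c))\}$, if and only if $G$ or its complement is a star $K_{1,n-1}$ or has exactly one edge. For $u^\star=u(c)$,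 the second bound without rounding is attained, i.e. $\ell(c)=S_1-\sigma^2/(u(c)-S_1)$, if and only if $G$ or its complement is a star $K_{1,n-1}$ or has exactly one edge. (c) One may always take $u^\star=\gamma_c$, where $\gamma_c=\lfloor c/2\rfloor\lceil c/2\rceil$ if $G$ is bipartite and $\gamma_c=c(c-1)/2$ otherwise, and $\ell_\star=c-\alpha^\star$, where $\alpha^\star$ is any integer upper bound on the independence number of $G$; that is, $u(c)\le\gamma_c$ and $c-\alpha^\star\le\ell(c)$. (d) The two rounded bounds in (a) can be computed in time linear in the size $m$ of $G$: there are constants $C,K$ and one program for a random access machine (unit cost per instruction; instructions: loading a constant, $+$, $-$, $\times$, integer division, indirect load and store, conditional jump; memory initially zero outside the input) which, for all $n$, $G$, $c$, $\ell_\star$, $u^\star$ as above with $V(G)=\{0,\dots,n-1\}$, given $n$, $c$, $\ell_\star$, $u^\star$, $m$ and any list of the edges of $G$, outputs both bounds after at most $Cm$ steps, all integers stored during the computation having absolute value at most $(n+|\ell_\star|+|u^\star|)^K$. -/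

import Mathlib

open scoped BigOperators

namespace InducedSizes

/-! ### Sizes of induced subgraphs of order `c` -/

section Graphs

/-- The size (number of edges) of the subgraph of `G` induced by the vertex set `U`. -/
noncomputable def size {V : Type*} (G : SimpleGraph V) (U : Finset V) : ℕ :=
  (G.induce (U : Set V)).edgeSet.ncard

/-- The set `R_c(G)` of the sizes of the induced subgraphs of `G` of order `c`. -/
def sizeRange {V : Type*} (G : SimpleGraph V) (c : ℕ) : Set ℕ :=
  {k | ∃ U : Finset V, U.card = c ∧ size G U = k}

/-- `ℓ(c)`: the minimum size of an induced subgraph of order `c`. -/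
noncomputable def minSize {V : Type*} (G : SimpleGraph V) (c : ℕ) : ℕ :=
  sInf (sizeRange G c)

/-- `u(c)`: the maximum size of an induced subgraph of order `c`. -/
noncomputable def maxSize {V : Type*} (G : SimpleGraph V) (c : ℕ) : ℕ :=
  sSup (sizeRange G c)

/-- First binomial moment `S₁(c) = E[M_c]`, where `M_c` is the size of the subgraph induced by a
uniformly random set of `c` vertices. -/
noncomputable def S1 {V : Type*} [Fintype V] (G : SimpleGraph V) (c : ℕ) : ℝ :=
  𝔼 U ∈ Finset.powersetCard c (Finset.univ : Finset V), (size G U : ℝ)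

/-- Second binomial moment `S₂(c) = E[M_c (M_c - 1)] / 2`. -/
noncomputable def S2 {V : Type*} [Fintype V] (G : SimpleGraph V) (c : ℕ) : ℝ :=
  (1 / 2) * 𝔼 U ∈ Finset.powersetCard c (Finset.univ : Finset V),
    (size G U : ℝ) * ((size G U : ℝ) - 1)

/-- The variance `σ²(c) = 2 S₂(c) - S₁(c) (S₁(c) - 1)` of `M_c`. -/
noncomputable def sigmaSq {V : Type*} [Fintype V] (G : SimpleGraph V) (c : ℕ) : ℝ :=
  2 * S2 G c - S1 G c * (S1 G c - 1)

/-- The (unrounded) lower bound on the maximum size `u(c)`, given `l ≤ ℓ(c)`. -/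
noncomputable def maxSizeBound {V : Type*} [Fintype V] (G : SimpleGraph V) (c : ℕ) (l : ℤ) : ℝ :=
  max (2 * S2 G c / S1 G c + 1) (S1 G c + sigmaSq G c / (S1 G c - l))

/-- The (unrounded) upper bound on the minimum size `ℓ(c)`, given `u(c) ≤ u`. -/
noncomputable def minSizeBound {V : Type*} [Fintype V] (G : SimpleGraph V) (c : ℕ) (u : ℤ) : ℝ :=
  S1 G c - sigmaSq G c / (u - S1 G c)

/-- `G` is a star spanning all the vertices, or it has exactly one edge. -/
def IsStarOrEdge {V : Type*} (G : SimpleGraph V) : Prop :=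
  (∃ r, G = SimpleGraph.starGraph r) ∨ ∃ a b, a ≠ b ∧ G = SimpleGraph.edge a b

open Classical in
/-- `γ_c`: the size of the balanced complete bipartite graph of order `c` if `G` is bipartite, and
the size of the complete graph of order `c` otherwise. -/
noncomputable def gammaBound {V : Type*} (G : SimpleGraph V) (c : ℕ) : ℕ :=
  if G.IsBipartite then (c / 2) * ((c + 1) / 2) else c.choose 2

end Graphs

/-! ### A random access machine -/

section Machine

/-- Instructions of a random access machine with integer words. The machine has directly addressed
registers and an indirectly addressed memory. Each instruction costs one step. -/
inductive Instr : Type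
  /-- `reg d := k` -/
  | const (d : ℕ) (k : ℤ)
  /-- `reg d := reg a + reg b` -/
  | add (d a b : ℕ)
  /-- `reg d := reg a - reg b` -/
  | sub (d a b : ℕ)
  /-- `reg d := reg a * reg b` -/
  | mul (d a b : ℕ)
  /-- `reg d := reg a / reg b`, integer division (rounding down if the divisor is positive) -/
  | div (d a b : ℕ)
  /-- `reg d := mem (reg a)` -/
  | load (d a : ℕ)
  /-- `mem (reg a) := reg s` -/
  | store (a s : ℕ)
  /-- if `reg r` is positive, continue with the instruction number `t` -/
  | jpos (r t : ℕ)

/-- A configuration: number of the next instruction, contents of the registers and of the memory. -/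
structure Config : Type where
  pc : ℕ
  reg : ℕ → ℤ
  mem : ℕ → ℤ

/-- Write `x` into register `d` and go to the next instruction. -/
def Config.write (s : Config) (d : ℕ) (x : ℤ) : Config :=
  { pc := s.pc + 1, reg := Function.update s.reg d x, mem := s.mem }

/-- Effect of one instruction (a negative address is read as the address `0`). -/
def Instr.exec : Instr → Config → Config
  | .const d k, s => s.write d k
  | .add d a b, s => s.write d (s.reg a + s.reg b)
  | .sub d a b, s => s.write d (s.reg a - s.reg b)
  | .mul d a b, s => s.write d (s.reg a * s.reg b)
  | .div d a b, s => s.write d (s.reg a / s.reg b)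
  | .load d a, s => s.write d (s.mem (s.reg a).toNat)
  | .store a i, s =>
      { pc := s.pc + 1, reg := s.reg, mem := Function.update s.mem (s.reg a).toNat (s.reg i) }
  | .jpos r t, s =>
      { pc := if 0 < s.reg r then t else s.pc + 1, reg := s.reg, mem := s.mem }

/-- One step of the program `P`; nothing happens any more once the machine has halted. -/
def step (P : List Instr) (s : Config) : Config :=
  match P[s.pc]? with
  | some i => i.exec s
  | none => s

/-- The configuration after `t` steps. -/
def run (P : List Instr) (t : ℕ) (s : Config) : Config := (step P)^[t] s

/-- The machine has halted: there is no instruction left to execute. -/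
def Halted (P : List Instr) (s : Config) : Prop := P.length ≤ s.pc

/-- All the words in the registers and in the memory have absolute value at most `B`. -/
def WordsBounded (s : Config) (B : ℕ) : Prop :=
  (∀ i, (s.reg i).natAbs ≤ B) ∧ ∀ i, (s.mem i).natAbs ≤ B

/-- `L` lists every edge of `G` exactly once, in some order and with some orientation. -/
def IsEdgeList {n : ℕ} (G : SimpleGraph (Fin n)) (L : List (Fin n × Fin n)) : Prop :=
  (L.map fun p => s(p.1, p.2)).Nodup ∧ ∀ e, e ∈ (L.map fun p => s(p.1, p.2)) ↔ e ∈ G.edgeSet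

/-- Initial configuration: the registers `0, …, 4` hold `n`, `c`, `l`, `u` and the number of edges,
the memory holds the end-points of the edges one after the other, all the other words are `0`. -/
def initial (n c : ℕ) (l u : ℤ) (L : List (Fin n × Fin n)) : Config where
  pc := 0
  reg := fun i => [(n : ℤ), (c : ℤ), l, u, (L.length : ℤ)].getD i 0
  mem := fun i => (L.flatMap fun p => [((p.1 : ℕ) : ℤ), ((p.2 : ℕ) : ℤ)]).getD i 0

end Machine

end InducedSizes

open InducedSizes

/-!
The bounds on the sizes come from one inequality. If a random variable `X` takes values in `[l, u]`,
then `E[(X - l) (u - X)] ≥ 0`, with equality exactly if `X` takes no other values than `l` and `u`.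
For `X = M_c` this says that `E[M_c (M_c - t)] / E[M_c - t]` (`momentRatio`) is at most `u(c)` for
`t ≤ ℓ(c)`, and at least `ℓ(c)` for `t ≥ u(c)`. All the bounds in question are values of this
function: the two terms of the lower bound for `u(c)` belong to `t = 0` and `t = l`, the upper bound
for `ℓ(c)` to `t = u`.

So the bounds are sharp exactly if the induced subgraphs of order `c` have only two sizes, `k` and
`k + d`. Such graphs are determined by exchanging vertices (`HasTwoSizes.isStarOrEdge`). Replacing
`x` by `y` changes the size by `0` or `± d`, so that the second differences of the adjacency
matrix, which are at most `2` in absolute value, are multiples of `d`.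
* If `d = 0` or `d ≥ 3`, then they vanish, and the graph is complete, edgeless, a star or the
  complement of a star (`eq_of_rectangle_eq_zero`).
* If `d = 2`, then they are even, so that two rows of the matrix either agree or differ at every
  vertex. In the latter case some set of `c - 1` vertices gives a change of at least `3`
  (`exists_three_le_abs_sum`), so all vertices are twins.
* If `d = 1`, then every vertex `x` has at most one neighbour that is not a neighbour of a given
  vertex `y`. As there are at least eight vertices, this forces the graph or its complement to be a
  matching (`eq_of_not_adj_of_four_le_card`), and two edges of a matching give a third size
  (`HasTwoSizes.edge_unique`).

In particular the size is not constant, which makes all denominators nonzero.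

For the algorithm, the first two moments are expressed by `n`, `c`, `m` and the number of pairs of
adjacent edges, by counting the pairs of edges with and without a common vertex
(`S1_eq_div`, `two_mul_S2_eq_div`). The program `boundProgram` finds the number of pairs of adjacent
edges in one pass through the edge list, keeping the current degrees in the memory, and then takes a
fixed number of arithmetical steps. Its words stay polynomial for a simple reason: the state at the
start of each round of the loop is known explicitly (`LoopInv`), and in each further step the
exponent of a power bounding all words at most doubles (`WordsBounded.step`).
-/


namespace InducedSizes

/-! ### Sizes of induced subgraphs -/

section Size

variable {V : Type*} (G : SimpleGraph V)

theorem size_eq_ncard (U : Finset V) :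
    size G U = {e | e ∈ G.edgeSet ∧ ∀ v ∈ e, v ∈ U}.ncard := by
  rw [size, ← Set.ncard_image_of_injective _
    (Sym2.map.injective (Subtype.val_injective (p := (· ∈ U))))]
  congr 1
  ext e
  induction e with | _ x y
  simp only [Set.mem_image, Set.mem_ofPred_eq, SimpleGraph.mem_edgeSet, Sym2.mem_iff,
    forall_eq_or_imp, forall_eq]
  constructor
  · rintro ⟨e, he, h⟩
    induction e with | _ a b
    rw [Sym2.map_mk, Sym2.eq_iff] at h
    rw [SimpleGraph.mem_edgeSet, SimpleGraph.comap_adj] at he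
    rcases h with ⟨rfl, rfl⟩ | ⟨rfl, rfl⟩
    · exact ⟨he, a.2, b.2⟩
    · exact ⟨he.symm, b.2, a.2⟩
  · rintro ⟨h, hx, hy⟩
    exact ⟨s(⟨x, hx⟩, ⟨y, hy⟩), h, rfl⟩

theorem size_eq_card_filter [DecidableEq V] [Fintype G.edgeSet] (U : Finset V) :
    size G U = (G.edgeFinset.filter fun e => e.toFinset ⊆ U).card := by
  rw [size_eq_ncard, ← Set.ncard_coe_finset]
  congr 1
  ext e
  simp [Finset.subset_iff]

@[simp]
theorem size_empty : size G ∅ = 0 := by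
  rw [size_eq_ncard]
  convert Set.ncard_empty (Sym2 V)
  ext e
  induction e with | _ x y
  simp only [Finset.notMem_empty, Set.mem_ofPred_eq, Set.mem_empty_iff_false, iff_false]
  exact fun h => h.2 x (by simp)

theorem size_insert [DecidableEq V] [DecidableRel G.Adj] {x : V} {W : Finset V} (hx : x ∉ W) :
    size G (insert x W) = size G W + (W.filter (G.Adj x)).card := by
  have hfin : ∀ U : Finset V, {e | e ∈ G.edgeSet ∧ ∀ v ∈ e, v ∈ U}.Finite := by
    intro U
    refine (U.sym2.finite_toSet).subset ?_
    rintro e ⟨-, he⟩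
    exact Finset.mem_coe.2 (Finset.mem_sym2_iff.2 he)
  have hinj : Function.Injective fun w => s(x, w) := fun a b => Sym2.congr_right.1
  rw [size_eq_ncard, size_eq_ncard, ← Finset.card_image_of_injective _ hinj,
    ← Set.ncard_coe_finset, ← Set.ncard_union_eq _ (hfin W) (Finset.finite_toSet _)]
  · congr 1
    ext e
    induction e with | _ a b
    simp only [Set.mem_ofPred_eq, SimpleGraph.mem_edgeSet, Sym2.mem_iff, forall_eq_or_imp,
      forall_eq, Finset.mem_insert, Set.mem_union, Finset.coe_image, Set.mem_image,
      Finset.coe_filter, Sym2.eq_iff]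
    constructor
    · rintro ⟨h, rfl | ha, rfl | hb⟩
      · exact absurd h G.irrefl
      · exact Or.inr ⟨b, ⟨hb, h⟩, by simp⟩
      · exact Or.inr ⟨a, ⟨ha, h.symm⟩, by simp⟩
      · exact Or.inl ⟨h, ha, hb⟩
    · rintro (⟨h, ha, hb⟩ | ⟨w, ⟨hw, h⟩, ⟨rfl, rfl⟩ | ⟨rfl, rfl⟩⟩)
      · exact ⟨h, Or.inr ha, Or.inr hb⟩
      · exact ⟨h, Or.inl rfl, Or.inr hw⟩
      · exact ⟨h.symm, Or.inr hw, Or.inl rfl⟩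
  · rw [Set.disjoint_left]
    rintro e ⟨-, he⟩ h
    obtain ⟨w, -, rfl⟩ := by simpa using h
    exact hx (he x (by simp))

theorem size_add_size_compl (U : Finset V) : size G U + size Gᶜ U = U.card.choose 2 := by
  classical
  induction U using Finset.induction_on with
  | empty => simp
  | insert x W hx ih =>
    rw [size_insert G hx, size_insert Gᶜ hx, Finset.card_insert_of_notMem hx]
    have h1 : W.filter (Gᶜ.Adj x) = W.filter fun w => ¬ G.Adj x w := by
      refine Finset.filter_congr fun w hw => ?_
      have : x ≠ w := fun h => hx (h ▸ hw)
      simp [SimpleGraph.compl_adj, this]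
    have h2 := Finset.card_filter_add_card_filter_not (s := W) (G.Adj x)
    have h3 : (W.card + 1).choose 2 = W.card + W.card.choose 2 := by
      rw [Nat.choose_succ_succ', Nat.choose_one_right]
    rw [h1]
    omega

theorem size_le_choose (U : Finset V) : size G U ≤ U.card.choose 2 := by
  have := size_add_size_compl G U
  omega

theorem size_le_of_isBipartite (h : G.IsBipartite) (U : Finset V) :
    size G U ≤ (U.card / 2) * ((U.card + 1) / 2) := by
  have hb : (G.induce (U : Set V)).IsBipartite :=
    SimpleGraph.Colorable.of_hom (SimpleGraph.Embedding.induce (U : Set V)).toHom h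
  have h4 := hb.four_mul_encard_edgeSet_le
  have hfin : (G.induce (U : Set V)).edgeSet.Finite := Set.toFinite _
  rw [← hfin.cast_ncard_eq, ENat.card_eq_coe_natCard] at h4
  have h5 : 4 * size G U ≤ U.card ^ 2 := by
    have : Nat.card ((U : Set V) : Type _) = U.card := by simp
    rw [this] at h4
    exact_mod_cast h4
  obtain ⟨k, hk | hk⟩ : ∃ k, U.card = 2 * k ∨ U.card = 2 * k + 1 := ⟨U.card / 2, by omega⟩
  · rw [hk] at h5 ⊢
    rw [show 2 * k / 2 = k by omega, show (2 * k + 1) / 2 = k by omega]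
    nlinarith
  · rw [hk] at h5 ⊢
    rw [show (2 * k + 1) / 2 = k by omega, show (2 * k + 1 + 1) / 2 = k + 1 by omega]
    have : 4 * size G U ≤ 4 * (k * (k + 1)) + 1 := by nlinarith
    omega

theorem size_le_gammaBound (U : Finset V) : size G U ≤ gammaBound G U.card := by
  unfold gammaBound
  split_ifs with h
  · exact size_le_of_isBipartite G h U
  · exact size_le_choose G U

/-- Deleting one end of every edge leaves an independent set. -/
theorem exists_isIndepSet_card (U : Finset V) :
    ∃ I ⊆ U, G.IsIndepSet (I : Set V) ∧ U.card ≤ I.card + size G U := by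
  classical
  induction U using Finset.strongInduction with
  | H U ih =>
    by_cases hU : G.IsIndepSet (U : Set V)
    · exact ⟨U, subset_rfl, hU, Nat.le_add_right _ _⟩
    · rw [SimpleGraph.isIndepSet_iff, Set.Pairwise] at hU
      push Not at hU
      obtain ⟨x, hx, y, hy, hxy, hadj⟩ := hU
      obtain ⟨I, hI, hind, hcard⟩ := ih _ (Finset.erase_ssubset hx)
      refine ⟨I, hI.trans (Finset.erase_subset _ _), hind, ?_⟩
      have h1 := size_insert G (Finset.notMem_erase x U)
      rw [Finset.insert_erase hx] at h1
      have h2 : 0 < ((U.erase x).filter (G.Adj x)).card :=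
        Finset.card_pos.2 ⟨y, by simp [hadj, Ne.symm hxy]; exact hy⟩
      have h3 := Finset.card_erase_add_one hx
      omega

theorem card_le_indepNum_add_size [Finite V] (U : Finset V) :
    U.card ≤ G.indepNum + size G U := by
  cases nonempty_fintype V
  obtain ⟨I, -, hI, hcard⟩ := exists_isIndepSet_card G U
  have := hI.card_le_indepNum
  omega

theorem bddAbove_sizeRange (c : ℕ) : BddAbove (sizeRange G c) := by
  refine ⟨c.choose 2, ?_⟩
  rintro _ ⟨U, rfl, rfl⟩
  exact size_le_choose G U

theorem size_le_maxSize {U : Finset V} {c : ℕ} (hU : U.card = c) : size G U ≤ maxSize G c :=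
  le_csSup (bddAbove_sizeRange G c) ⟨U, hU, rfl⟩

theorem minSize_le_size {U : Finset V} {c : ℕ} (hU : U.card = c) : minSize G c ≤ size G U :=
  Nat.sInf_le ⟨U, hU, rfl⟩

variable [Fintype V]

theorem sizeRange_nonempty {c : ℕ} (hc : c ≤ Fintype.card V) : (sizeRange G c).Nonempty := by
  obtain ⟨U, -, hU⟩ := Finset.exists_subset_card_eq (s := (Finset.univ : Finset V)) hc
  exact ⟨_, U, hU, rfl⟩

theorem exists_size_eq_maxSize {c : ℕ} (hc : c ≤ Fintype.card V) :
    ∃ U : Finset V, U.card = c ∧ size G U = maxSize G c :=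
  Nat.sSup_mem (sizeRange_nonempty G hc) (bddAbove_sizeRange G c)

theorem exists_size_eq_minSize {c : ℕ} (hc : c ≤ Fintype.card V) :
    ∃ U : Finset V, U.card = c ∧ size G U = minSize G c :=
  Nat.sInf_mem (sizeRange_nonempty G hc)

end Size

/-! ### Graphs whose induced subgraphs of order `c` have two sizes -/

section TwoSizes

variable {V : Type*} (G : SimpleGraph V)

open Classical in
/-- The entries of the adjacency matrix, as integers. -/
noncomputable def adjInt (x y : V) : ℤ := if G.Adj x y then 1 else 0

theorem adjInt_comm (x y : V) : adjInt G x y = adjInt G y x := by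
  by_cases h : G.Adj x y
  · simp [adjInt, h, h.symm]
  · simpa [adjInt, h] using fun e : G.Adj y x => h e.symm

theorem adjInt_eq_zero_or_one (x y : V) : adjInt G x y = 0 ∨ adjInt G x y = 1 := by
  unfold adjInt; split_ifs <;> simp

theorem adjInt_eq_one {x y : V} : adjInt G x y = 1 ↔ G.Adj x y := by simp [adjInt]

theorem adjInt_eq_zero {x y : V} : adjInt G x y = 0 ↔ ¬ G.Adj x y := by simp [adjInt]

theorem size_insert_adjInt [DecidableEq V] {x : V} {W : Finset V} (hx : x ∉ W) :
    (size G (insert x W) : ℤ) = size G W + ∑ w ∈ W, adjInt G x w := by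
  classical
  rw [size_insert G hx]
  simp [adjInt]

/-- Every induced subgraph of order `c` has size `k` or `k + d`. -/
def HasTwoSizes (c k d : ℕ) : Prop :=
  ∀ U : Finset V, U.card = c → size G U = k ∨ size G U = k + d

variable {G} {c k d : ℕ}

theorem HasTwoSizes.compl (h : HasTwoSizes G c k d) : ∃ k', HasTwoSizes Gᶜ c k' d := by
  by_cases hk : k + d ≤ c.choose 2
  · refine ⟨c.choose 2 - (k + d), fun U hU => ?_⟩
    have := size_add_size_compl G U
    have := h U hU
    rw [hU] at *
    omega
  · refine ⟨c.choose 2 - k, fun U hU => ?_⟩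
    have := size_add_size_compl G U
    have := h U hU
    rw [hU] at *
    omega

/-- Exchanging one vertex of a set of `c` vertices changes the size of the induced subgraph by a
difference of two degrees. -/
theorem HasTwoSizes.exchange (h : HasTwoSizes G c k d) {x y : V} {W : Finset V} (hx : x ∉ W)
    (hy : y ∉ W) (hW : W.card + 1 = c) :
    ∃ i : ℤ, (i = -1 ∨ i = 0 ∨ i = 1) ∧ ∑ w ∈ W, (adjInt G x w - adjInt G y w) = d * i := by
  classical
  have h1 := size_insert_adjInt G hx
  have h2 := size_insert_adjInt G hy
  have h3 := h (insert x W) (by rw [Finset.card_insert_of_notMem hx, hW])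
  have h4 := h (insert y W) (by rw [Finset.card_insert_of_notMem hy, hW])
  rw [Finset.sum_sub_distrib]
  rcases h3 with h3 | h3 <;> rcases h4 with h4 | h4 <;> rw [h3] at h1 <;> rw [h4] at h2 <;>
    push_cast at h1 h2
  · exact ⟨0, by simp, by linarith⟩
  · exact ⟨-1, by simp, by linarith⟩
  · exact ⟨1, by simp, by linarith⟩
  · exact ⟨0, by simp, by linarith⟩

theorem HasTwoSizes.exchange_le (h : HasTwoSizes G c k d) {x y : V} {W : Finset V} (hx : x ∉ W)
    (hy : y ∉ W) (hW : W.card + 1 = c) : ∑ w ∈ W, (adjInt G x w - adjInt G y w) ≤ d := by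
  obtain ⟨i, hi, hs⟩ := h.exchange hx hy hW
  rw [hs]
  rcases hi with rfl | rfl | rfl <;> simp

/-- If `|N(x) \ N[y]| ≤ 1` for all `x` and `y`, and some vertex has four neighbours, then no vertex
misses two other vertices. -/
theorem eq_of_not_adj_of_four_le_card
    (h : ∀ x y w w' : V, y ≠ w → y ≠ w' → w ≠ w' → G.Adj x w → G.Adj x w' →
      G.Adj y w ∨ G.Adj y w') {x : V} {N : Finset V} (hN : ∀ w ∈ N, G.Adj x w)
    (hcard : 4 ≤ N.card) {v p q : V} (hvp : v ≠ p) (hvq : v ≠ q) (hp : ¬ G.Adj v p)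
    (hq : ¬ G.Adj v q) : p = q := by
  classical
  by_contra hpq
  have hM : ∀ y, (N.filter fun w => y ≠ w ∧ ¬ G.Adj y w).card ≤ 1 := by
    intro y
    rw [Finset.card_le_one]
    intro w hw w' hw'
    rw [Finset.mem_filter] at hw hw'
    by_contra hne
    by_cases hxy : x = y
    · exact hw.2.2 (hxy ▸ hN w hw.1)
    · rcases h x y w w' hw.2.1 hw'.2.1 hne (hN w hw.1) (hN w' hw'.1) with h1 | h1
      · exact hw.2.2 h1
      · exact hw'.2.2 h1
  have hsub : N ⊆ (N.filter fun w => v ≠ w ∧ ¬ G.Adj v w) ∪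
      ((N.filter fun w => p ≠ w ∧ ¬ G.Adj p w) ∪ (N.filter fun w => q ≠ w ∧ ¬ G.Adj q w)) := by
    intro w hw
    simp only [Finset.mem_union, Finset.mem_filter, hw, true_and]
    by_cases hwv : w = v
    · subst hwv
      exact Or.inr (Or.inl ⟨Ne.symm hvp, fun e => hp e.symm⟩)
    by_cases hwp : w = p
    · subst hwp
      exact Or.inl ⟨hvp, hp⟩
    by_cases hwq : w = q
    · subst hwq
      exact Or.inl ⟨hvq, hq⟩
    by_contra! hcon
    -- `w` is adjacent to `p` and `q`, and `v` to neither of them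
    rcases h w v p q hvp hvq hpq (hcon.2.1 (Ne.symm hwp)).symm
      (hcon.2.2 (Ne.symm hwq)).symm with h1 | h1
    · exact hp h1
    · exact hq h1
  have h1 := Finset.card_le_card hsub
  have h2 := Finset.card_union_le (N.filter fun w => v ≠ w ∧ ¬ G.Adj v w)
    ((N.filter fun w => p ≠ w ∧ ¬ G.Adj p w) ∪ (N.filter fun w => q ≠ w ∧ ¬ G.Adj q w))
  have h3 := Finset.card_union_le (N.filter fun w => p ≠ w ∧ ¬ G.Adj p w)
    (N.filter fun w => q ≠ w ∧ ¬ G.Adj q w)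
  have := hM v
  have := hM p
  have := hM q
  omega

variable [Fintype V]

/-- A set of prescribed size avoiding given vertices. -/
theorem exists_disjoint_card_eq [DecidableEq V] (A : Finset V) {r : ℕ}
    (h : r + A.card ≤ Fintype.card V) : ∃ W : Finset V, Disjoint A W ∧ W.card = r := by
  have h1 : r ≤ (Aᶜ).card := by rw [Finset.card_compl]; omega
  obtain ⟨W, hW, hcard⟩ := Finset.exists_subset_card_eq h1
  exact ⟨W, (Finset.disjoint_left.2 fun a ha hw => Finset.mem_compl.1 (hW hw) ha), hcard⟩

/-- The second difference: exchanging `x` with `y` and `w` with `w'`. -/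
theorem HasTwoSizes.dvd_rectangle (h : HasTwoSizes G c k d) (hc : 2 ≤ c)
    (hn : c + 2 ≤ Fintype.card V) {x y w w' : V} (hxw : x ≠ w) (hxw' : x ≠ w')
    (hyw : y ≠ w) (hyw' : y ≠ w') :
    (d : ℤ) ∣ adjInt G x w - adjInt G y w - (adjInt G x w' - adjInt G y w') := by
  classical
  obtain ⟨W, hdis, hW⟩ := exists_disjoint_card_eq ({x, y, w, w'} : Finset V) (r := c - 2) (by
    have := Finset.card_le_four (a := x) (b := y) (c := w) (d := w')
    omega)
  simp only [Finset.disjoint_insert_left, Finset.disjoint_singleton_left] at hdis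
  obtain ⟨hx, hy, hw, hw'⟩ := hdis
  obtain ⟨i, -, hi⟩ := h.exchange (x := x) (y := y) (W := insert w W) (by simp [*]) (by simp [*])
    (by rw [Finset.card_insert_of_notMem hw]; omega)
  obtain ⟨j, -, hj⟩ := h.exchange (x := x) (y := y) (W := insert w' W) (by simp [*]) (by simp [*])
    (by rw [Finset.card_insert_of_notMem hw']; omega)
  rw [Finset.sum_insert hw] at hi
  rw [Finset.sum_insert hw'] at hj
  exact ⟨i - j, by linarith⟩

theorem exists_notMem_of_card_lt {A : Finset V} (h : A.card < Fintype.card V) : ∃ v, v ∉ A := by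
  by_contra! hall
  rw [Finset.eq_univ_iff_forall.2 hall, Finset.card_univ] at h
  exact lt_irrefl _ h

/-- If all vertices are twins, then the graph is complete or edgeless. -/
theorem eq_top_or_eq_bot_of_twins (hn : 4 ≤ Fintype.card V)
    (htwin : ∀ x y w : V, x ≠ w → y ≠ w → adjInt G x w = adjInt G y w) : G = ⊤ ∨ G = ⊥ := by
  classical
  by_cases hG : G = ⊥
  · exact Or.inr hG
  left
  obtain ⟨a, b, hab⟩ := SimpleGraph.ne_bot_iff_exists_adj.1 hG
  ext x y
  simp only [SimpleGraph.top_adj]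
  refine ⟨fun hxy => hxy.ne, fun hxy => ?_⟩
  obtain ⟨z, hz⟩ := exists_notMem_of_card_lt (A := {a, b, y})
    (lt_of_le_of_lt Finset.card_le_three hn)
  simp only [Finset.mem_insert, Finset.mem_singleton, not_or] at hz
  -- move the ends of the edge one at a time
  have e1 : adjInt G z b = 1 := (htwin z a b hz.2.1 hab.ne).trans ((adjInt_eq_one G).2 hab)
  have e2 : adjInt G z y = 1 := by
    rw [adjInt_comm] at e1 ⊢
    exact (htwin y b z (Ne.symm hz.2.2) (Ne.symm hz.2.1)).trans e1
  exact (adjInt_eq_one G).1 ((htwin x z y hxy hz.2.2).trans e2)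

/-- If all second differences vanish, then any two rows of the adjacency matrix differ by a
constant, which leaves few graphs. -/
theorem eq_of_rectangle_eq_zero (hn : 4 ≤ Fintype.card V)
    (h : ∀ x y w w' : V, x ≠ y → x ≠ w → x ≠ w' → y ≠ w → y ≠ w' → w ≠ w' →
      adjInt G x w - adjInt G y w - (adjInt G x w' - adjInt G y w') = 0) :
    G = ⊤ ∨ G = ⊥ ∨ (∃ r, G = SimpleGraph.starGraph r) ∨ ∃ r, Gᶜ = SimpleGraph.starGraph r := by
  by_cases htwin : ∀ x y w : V, x ≠ w → y ≠ w → adjInt G x w = adjInt G y w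
  · rcases eq_top_or_eq_bot_of_twins hn htwin with h1 | h1
    · exact Or.inl h1
    · exact Or.inr (Or.inl h1)
  · right; right
    push Not at htwin
    obtain ⟨x, y, w, hxw, hyw, hne⟩ := htwin
    have hxy : x ≠ y := fun e => hne (by rw [e])
    wlog hw : adjInt G x w = 1 ∧ adjInt G y w = 0 generalizing x y
    · refine this y x hyw hxw (Ne.symm hne) (Ne.symm hxy) ?_
      rcases adjInt_eq_zero_or_one G x w with h1 | h1 <;>
        rcases adjInt_eq_zero_or_one G y w with h2 | h2 <;> simp_all
    have hz : ∀ z, z ≠ x → z ≠ y → adjInt G x z = 1 ∧ adjInt G y z = 0 := by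
      intro z hzx hzy
      by_cases hzw : z = w
      · rw [hzw]; exact hw
      · have := h x y w z hxy hxw (Ne.symm hzx) hyw (Ne.symm hzy) (Ne.symm hzw)
        rcases adjInt_eq_zero_or_one G x z with h1 | h1 <;>
          rcases adjInt_eq_zero_or_one G y z with h2 | h2 <;> omega
    have hzz : ∀ z z', z ≠ x → z ≠ y → z' ≠ x → z' ≠ y → z ≠ z' →
        adjInt G z z' = 1 - adjInt G x y := by
      intro z z' h1 h2 h3 h4 h5
      have := h z y x z' h2 h1 h5 (Ne.symm hxy) (Ne.symm h4) (Ne.symm h3)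
      rw [adjInt_comm G z x, adjInt_comm G y x, (hz z h1 h2).1, (hz z' h3 h4).2] at this
      omega
    rcases adjInt_eq_zero_or_one G x y with hxy0 | hxy1
    · right
      refine ⟨y, ?_⟩
      ext p q
      rw [SimpleGraph.starGraph_adj, SimpleGraph.compl_adj, ← adjInt_eq_zero]
      refine and_congr_right fun hpq => ?_
      by_cases hpy : p = y
      · subst hpy
        by_cases hqx : q = x
        · subst hqx; simp [adjInt_comm G p, hxy0]
        · simp [(hz q hqx (Ne.symm hpq)).2]
      by_cases hqy : q = y
      · subst hqy
        by_cases hpx : p = x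
        · subst hpx; simp [hxy0]
        · simp [adjInt_comm G p, (hz p hpx hpq).2]
      simp only [hpy, hqy, or_self, iff_false]
      by_cases hpx : p = x
      · subst hpx; simp [(hz q (Ne.symm hpq) hqy).1]
      by_cases hqx : q = x
      · subst hqx; simp [adjInt_comm G p, (hz p hpq hpy).1]
      simp [hzz p q hpx hpy hqx hqy hpq, hxy0]
    · left
      refine ⟨x, ?_⟩
      ext p q
      rw [SimpleGraph.starGraph_adj, ← adjInt_eq_one]
      by_cases hpq : p = q
      · subst hpq; simp [adjInt]
      simp only [ne_eq, hpq, not_false_eq_true, true_and]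
      by_cases hpx : p = x
      · subst hpx
        by_cases hqy : q = y
        · subst hqy; simp [hxy1]
        · simp [(hz q (Ne.symm hpq) hqy).1]
      by_cases hqx : q = x
      · subst hqx
        by_cases hpy : p = y
        · subst hpy; simp [adjInt_comm G p, hxy1]
        · simp [adjInt_comm G p, (hz p hpx hpy).1]
      simp only [hpx, hqx, or_self, iff_false]
      by_cases hpy : p = y
      · subst hpy; simp [(hz q hqx (Ne.symm hpq)).2]
      by_cases hqy : q = y
      · subst hqy; simp [adjInt_comm G p, (hz p hpx hpq).2]
      simp [hzz p q hpx hpy hqx hqy hpq, hxy1]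

/-- Among more than `r + 2` signs there are `r` with a sum of absolute value at least `3`. -/
theorem exists_three_le_abs_sum {ι : Type*} {S : Finset ι} {e : ι → ℤ}
    (he : ∀ w ∈ S, e w = 1 ∨ e w = -1) {r : ℕ} (hr : 3 ≤ r) (hS : r + 3 ≤ S.card) :
    ∃ W ⊆ S, W.card = r ∧ 3 ≤ |∑ w ∈ W, e w| := by
  classical
  wlog hle : (S.filter fun w => ¬ e w = 1).card ≤ (S.filter fun w => e w = 1).card
      generalizing e
  · have hneg : ∀ w ∈ S, (-e w = 1 ↔ ¬ e w = 1) := by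
      intro w hw
      rcases he w hw with h | h <;> simp [h]
    obtain ⟨W, hW, hcard, hsum⟩ := this (e := fun w => -e w)
      (fun w hw => by rcases he w hw with h | h <;> simp [h]) (by
        rw [Finset.filter_congr hneg, Finset.filter_congr fun w hw => not_congr (hneg w hw)]
        simp only [not_not]
        exact (not_le.1 hle).le)
    exact ⟨W, hW, hcard, by simpa [Finset.sum_neg_distrib] using hsum⟩
  have hadd := Finset.card_filter_add_card_filter_not (s := S) fun w => e w = 1
  obtain ⟨A, hA, hAc⟩ := Finset.exists_subset_card_eq
    (min_le_left (S.filter fun w => e w = 1).card r)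
  obtain ⟨B, hB, hBc⟩ := Finset.exists_subset_card_eq
    (s := S.filter fun w => ¬ e w = 1) (n := r - A.card) (by omega)
  have hdis : Disjoint A B :=
    (Finset.disjoint_filter_filter_not S S fun w => e w = 1).mono hA hB
  refine ⟨A ∪ B, Finset.union_subset (hA.trans (Finset.filter_subset _ _))
    (hB.trans (Finset.filter_subset _ _)), ?_, ?_⟩
  · rw [Finset.card_union_of_disjoint hdis]; omega
  · have h1 : ∑ w ∈ A, e w = A.card := by
      rw [Finset.sum_congr rfl fun w hw => (Finset.mem_filter.1 (hA hw)).2]; simp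
    have h2 : ∑ w ∈ B, e w = -B.card := by
      rw [Finset.sum_congr rfl fun w hw => (he w (Finset.mem_filter.1 (hB hw)).1).resolve_left
        (Finset.mem_filter.1 (hB hw)).2]
      simp
    rw [Finset.sum_union hdis, h1, h2]
    refine le_trans ?_ (le_abs_self _)
    omega

theorem HasTwoSizes.twins_of_two (h : HasTwoSizes G c k 2) (hc : 4 ≤ c)
    (hn : c + 4 ≤ Fintype.card V) {x y w : V} (hxw : x ≠ w) (hyw : y ≠ w) :
    adjInt G x w = adjInt G y w := by
  classical
  by_contra hne
  have hodd : ∀ z ∈ ({x, y} : Finset V)ᶜ,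
      adjInt G x z - adjInt G y z = 1 ∨ adjInt G x z - adjInt G y z = -1 := by
    intro z hz
    simp only [Finset.mem_compl, Finset.mem_insert, Finset.mem_singleton, not_or] at hz
    have hdvd := h.dvd_rectangle (by omega) (by omega) hxw (Ne.symm hz.1) hyw (Ne.symm hz.2)
    rcases adjInt_eq_zero_or_one G x w with h1 | h1 <;>
      rcases adjInt_eq_zero_or_one G y w with h2 | h2 <;>
      rcases adjInt_eq_zero_or_one G x z with h3 | h3 <;>
      rcases adjInt_eq_zero_or_one G y z with h4 | h4 <;>
      rw [h1, h2] at hne <;> rw [h1, h2, h3, h4] at hdvd <;> rw [h3, h4] <;> omega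
  obtain ⟨W, hW, hcard, hsum⟩ := exists_three_le_abs_sum hodd (r := c - 1) (by omega) (by
    have := Finset.card_le_two (a := x) (b := y)
    rw [Finset.card_compl]; omega)
  have hx : x ∉ W := fun hx => by simpa using hW hx
  have hy : y ∉ W := fun hy => by simpa using hW hy
  obtain ⟨i, hi, hs⟩ := h.exchange hx hy (by omega)
  rw [hs] at hsum
  rcases hi with rfl | rfl | rfl <;> norm_num at hsum

theorem HasTwoSizes.twins_of_zero (h : HasTwoSizes G c k 0) (hc : 2 ≤ c)
    (hn : c + 2 ≤ Fintype.card V) {x y w : V} (hxw : x ≠ w) (hyw : y ≠ w) :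
    adjInt G x w = adjInt G y w := by
  classical
  obtain ⟨W, hdis, hW⟩ := exists_disjoint_card_eq ({x, y, w} : Finset V) (r := c - 2) (by
    have := Finset.card_le_three (a := x) (b := y) (c := w)
    omega)
  simp only [Finset.disjoint_insert_left, Finset.disjoint_singleton_left] at hdis
  obtain ⟨hx, hy, hw⟩ := hdis
  have hconst : ∀ z ∈ insert w W,
      adjInt G x z - adjInt G y z = adjInt G x w - adjInt G y w := by
    intro z hz
    have hxz : x ≠ z := fun e => by simp [← e, hxw, hx] at hz
    have hyz : y ≠ z := fun e => by simp [← e, hyw, hy] at hz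
    have hdvd := h.dvd_rectangle hc hn hxz hxw hyz hyw
    rw [Nat.cast_zero, zero_dvd_iff] at hdvd
    linarith
  obtain ⟨i, -, hi⟩ := h.exchange (x := x) (y := y) (W := insert w W) (by simp [*]) (by simp [*])
    (by rw [Finset.card_insert_of_notMem hw]; omega)
  rw [Finset.sum_congr rfl hconst, Finset.sum_const, Nat.cast_zero, zero_mul, smul_eq_zero,
    Finset.card_insert_of_notMem hw] at hi
  rcases hi with hi | hi
  · omega
  · linarith

/-- If the two sizes are consecutive, then a vertex `x` has at most one neighbour that is not a
neighbour of `y`. -/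
theorem HasTwoSizes.adj_or_adj (h : HasTwoSizes G c k 1) (hc : 4 ≤ c)
    (hn : c + 4 ≤ Fintype.card V) {x y w w' : V} (hyw : y ≠ w) (hyw' : y ≠ w')
    (hww' : w ≠ w') (hw : G.Adj x w) (hw' : G.Adj x w') : G.Adj y w ∨ G.Adj y w' := by
  classical
  by_contra! hcon
  set e : V → ℤ := fun z => adjInt G x z - adjInt G y z with he
  have hew : e w = 1 := by
    simp [he, (adjInt_eq_one G).2 hw, (adjInt_eq_zero G).2 hcon.1]
  have hew' : e w' = 1 := by
    simp [he, (adjInt_eq_one G).2 hw', (adjInt_eq_zero G).2 hcon.2]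
  have hval : ∀ z, e z = -1 ∨ 0 ≤ e z := by
    intro z
    simp only [he]
    rcases adjInt_eq_zero_or_one G x z with h1 | h1 <;>
      rcases adjInt_eq_zero_or_one G y z with h2 | h2 <;> simp [h1, h2]
  -- all sums of `c - 3` further values of `e` are negative
  have hneg : ∀ T : Finset V, Disjoint ({x, y, w, w'} : Finset V) T → T.card + 3 = c →
      ∑ z ∈ T, e z ≤ -1 := by
    intro T hT hcard
    simp only [Finset.disjoint_insert_left, Finset.disjoint_singleton_left] at hT
    obtain ⟨hxT, hyT, hwT, hwT'⟩ := hT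
    have hwi : w ∉ insert w' T := by simp [hww', hwT]
    have := h.exchange_le (x := x) (y := y) (W := insert w (insert w' T))
      (by simp [hw.ne, hw'.ne, hxT]) (by simp [hyw, hyw', hyT])
      (by rw [Finset.card_insert_of_notMem hwi, Finset.card_insert_of_notMem hwT']; omega)
    rw [Finset.sum_insert hwi, Finset.sum_insert hwT'] at this
    simp only [← he] at this
    change e w + (e w' + ∑ z ∈ T, e z) ≤ _ at this
    rw [hew, hew'] at this
    push_cast at this
    linarith
  set R : Finset V := ({x, y, w, w'} : Finset V)ᶜ with hR
  have hRcard : c ≤ R.card := by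
    have := Finset.card_le_four (a := x) (b := y) (c := w) (d := w')
    rw [hR, Finset.card_compl]; omega
  have hdisR : ∀ T ⊆ R, Disjoint ({x, y, w, w'} : Finset V) T := fun T hT =>
    Finset.disjoint_left.2 fun a ha hat => Finset.mem_compl.1 (hT hat) ha
  -- so at least two of these values are negative
  have hN : 1 < (R.filter fun z => e z = -1).card := by
    by_contra! hN
    have hadd := Finset.card_filter_add_card_filter_not (s := R) fun z => e z = -1
    obtain ⟨T, hT, hTc⟩ := Finset.exists_subset_card_eq
      (s := R.filter fun z => ¬ e z = -1) (n := c - 3) (by omega)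
    have h1 := hneg T (hdisR T (hT.trans (Finset.filter_subset _ _))) (by omega)
    have h2 : 0 ≤ ∑ z ∈ T, e z := Finset.sum_nonneg fun z hz =>
      (hval z).resolve_left (Finset.mem_filter.1 (hT hz)).2
    linarith
  obtain ⟨r, hr, r', hr', hrr'⟩ := Finset.one_lt_card.1 hN
  rw [Finset.mem_filter] at hr hr'
  obtain ⟨T, hT, hTc⟩ := Finset.exists_subset_card_eq
    (s := R \ {r, r'}) (n := c - 3) (by
      have h1 := Finset.le_card_sdiff {r, r'} R
      have h2 := Finset.card_le_two (a := r) (b := r')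
      omega)
  have hTR : T ⊆ R := hT.trans Finset.sdiff_subset
  have h1 := hneg T (hdisR T hTR) (by omega)
  have hrT : r' ∉ T := fun hmem => by simpa using (Finset.mem_sdiff.1 (hT hmem)).2
  have hrT' : r ∉ insert r' T := by
    rw [Finset.mem_insert, not_or]
    exact ⟨hrr', fun hmem => by simpa using (Finset.mem_sdiff.1 (hT hmem)).2⟩
  have hsub : insert r (insert r' T) ⊆ R :=
    Finset.insert_subset hr.1 (Finset.insert_subset hr'.1 hTR)
  have h2 := h.exchange_le (x := y) (y := x) (W := insert r (insert r' T))
    (fun hmem => by simpa [hR] using hsub hmem) (fun hmem => by simpa [hR] using hsub hmem)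
    (by rw [Finset.card_insert_of_notMem hrT', Finset.card_insert_of_notMem hrT]; omega)
  have h3 : ∑ z ∈ insert r (insert r' T), (adjInt G y z - adjInt G x z)
      = -∑ z ∈ insert r (insert r' T), e z := by
    rw [← Finset.sum_neg_distrib]
    exact Finset.sum_congr rfl fun z _ => by simp [he]
  rw [h3, Finset.sum_insert hrT', Finset.sum_insert hrT, hr.2, hr'.2] at h2
  push_cast at h2
  linarith

/-- A matching whose induced subgraphs of order `c` have two consecutive sizes has at most one
edge: two edges and two suitable outer vertices would give a third size. -/
theorem HasTwoSizes.edge_unique (h : HasTwoSizes G c k 1) (hc : 4 ≤ c)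
    (hn : c + 4 ≤ Fintype.card V) (hm : ∀ v p q : V, G.Adj v p → G.Adj v q → p = q)
    {a b a' b' : V} (hab : G.Adj a b) (hab' : G.Adj a' b') : s(a, b) = s(a', b') := by
  classical
  by_contra hne
  have hnb : ∀ v, (G.neighborFinset v).card ≤ 1 := by
    intro v
    rw [Finset.card_le_one]
    intro p hp q hq
    exact hm v p q ((G.mem_neighborFinset v p).1 hp) ((G.mem_neighborFinset v q).1 hq)
  have haa' : a ≠ a' := by
    rintro rfl
    exact hne (by rw [hm a b b' hab hab'])
  have hab'' : a ≠ b' := by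
    rintro rfl
    exact hne (by rw [hm a b a' hab hab'.symm, Sym2.eq_swap])
  have hba' : b ≠ a' := by
    rintro rfl
    exact hne (by rw [hm b a b' hab.symm hab', Sym2.eq_swap])
  have hbb' : b ≠ b' := by
    rintro rfl
    exact hne (by rw [hm b a a' hab.symm hab'.symm])
  have h4 := Finset.card_le_four (a := a) (b := b) (c := a') (d := b')
  obtain ⟨Y, hYd, hYc⟩ := exists_disjoint_card_eq ({a, b, a', b'} : Finset V) (r := 1) (by omega)
  obtain ⟨y, rfl⟩ := Finset.card_eq_one.1 hYc
  obtain ⟨Z, hZd, hZc⟩ := exists_disjoint_card_eq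
    (insert y ({a, b, a', b'} ∪ G.neighborFinset y) : Finset V) (r := 1) (by
      have h5 := Finset.card_insert_le y ({a, b, a', b'} ∪ G.neighborFinset y)
      have h6 := Finset.card_union_le {a, b, a', b'} (G.neighborFinset y)
      have := hnb y
      omega)
  obtain ⟨z, rfl⟩ := Finset.card_eq_one.1 hZc
  obtain ⟨W, hWd, hWc⟩ := exists_disjoint_card_eq
    (insert z (insert y ({a, b, a', b'} ∪ (G.neighborFinset y ∪ G.neighborFinset z))) : Finset V)
    (r := c - 4) (by
      have h5 := Finset.card_insert_le z
        (insert y ({a, b, a', b'} ∪ (G.neighborFinset y ∪ G.neighborFinset z)))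
      have h6 := Finset.card_insert_le y
        ({a, b, a', b'} ∪ (G.neighborFinset y ∪ G.neighborFinset z))
      have h7 := Finset.card_union_le {a, b, a', b'} (G.neighborFinset y ∪ G.neighborFinset z)
      have h8 := Finset.card_union_le (G.neighborFinset y) (G.neighborFinset z)
      have := hnb y
      have := hnb z
      omega)
  simp only [Finset.disjoint_singleton_right, Finset.mem_insert, Finset.mem_singleton,
    Finset.mem_union, not_or, SimpleGraph.mem_neighborFinset] at hYd hZd
  simp only [Finset.disjoint_insert_left, Finset.disjoint_union_left,
    Finset.disjoint_singleton_left] at hWd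
  obtain ⟨hya, hyb, hya', hyb'⟩ := hYd
  obtain ⟨hzy, ⟨hza, hzb, hza', hzb'⟩, hyz⟩ := hZd
  obtain ⟨hzW, hyW, ⟨haW, hbW, haW', hbW'⟩, hNy, hNz⟩ := hWd
  set T : Finset V := insert b (insert b' W) with hT
  have hbT : b ∉ insert b' W := by simp [hbb', hbW]
  have hTc : T.card + 2 = c := by
    rw [hT, Finset.card_insert_of_notMem hbT, Finset.card_insert_of_notMem hbW']
    omega
  -- neither `y` nor `z` has a neighbour in `T`
  have hfree : ∀ v, v ≠ a → v ≠ a' → Disjoint (G.neighborFinset v) W →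
      T.filter (G.Adj v) = ∅ := by
    intro v hva hva' hvW
    refine Finset.filter_eq_empty_iff.2 fun t ht hvt => ?_
    rw [hT, Finset.mem_insert, Finset.mem_insert] at ht
    rcases ht with rfl | rfl | ht
    · exact hva (hm t v a hvt.symm hab.symm)
    · exact hva' (hm t v a' hvt.symm hab'.symm)
    · exact Finset.disjoint_left.1 hvW ((G.mem_neighborFinset v t).2 hvt) ht
  have hyT : y ∉ T := by simp [hT, hyb, hyb', hyW]
  have hzT : z ∉ insert y T := by simp [hT, hzy, hzb, hzb', hzW]
  have haT : a ∉ T := by simp [hT, hab.ne, hab'', haW]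
  have haT' : a' ∉ insert a T := by simp [hT, Ne.symm haa', Ne.symm hba', hab'.ne, haW']
  have s1 : size G (insert z (insert y T)) = size G T := by
    rw [size_insert G hzT, size_insert G hyT, Finset.filter_insert (G.Adj z) y,
      if_neg (fun e => hyz e.symm), hfree y hya hya' hNy, hfree z hza hza' hNz]
    simp
  have s2 : size G T + 2 ≤ size G (insert a' (insert a T)) := by
    have h1 : 0 < (T.filter (G.Adj a)).card :=
      Finset.card_pos.2 ⟨b, by simp [hT, hab]⟩
    have h2 : 0 < ((insert a T).filter (G.Adj a')).card :=
      Finset.card_pos.2 ⟨b', by simp [hT, hab']⟩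
    rw [size_insert G haT', size_insert G haT]
    omega
  have t1 := h (insert z (insert y T)) (by
    rw [Finset.card_insert_of_notMem hzT, Finset.card_insert_of_notMem hyT]; omega)
  have t2 := h (insert a' (insert a T)) (by
    rw [Finset.card_insert_of_notMem haT', Finset.card_insert_of_notMem haT]; omega)
  omega

theorem HasTwoSizes.exists_eq_edge (h : HasTwoSizes G c k 1) (hc : 4 ≤ c)
    (hn : c + 4 ≤ Fintype.card V) (hbot : G ≠ ⊥)
    (hm : ∀ v p q : V, G.Adj v p → G.Adj v q → p = q) :
    ∃ a b, a ≠ b ∧ G = SimpleGraph.edge a b := by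
  obtain ⟨a, b, hab⟩ := SimpleGraph.ne_bot_iff_exists_adj.1 hbot
  refine ⟨a, b, hab.ne, ?_⟩
  ext p q
  rw [SimpleGraph.adj_edge]
  constructor
  · intro hpq
    exact ⟨h.edge_unique hc hn hm hab hpq, hpq.ne⟩
  · rintro ⟨h1, -⟩
    rwa [← SimpleGraph.mem_edgeSet, ← h1, SimpleGraph.mem_edgeSet]

/-- Only stars, single edges and their complements have just two sizes of induced subgraphs of
order `c`. -/
theorem HasTwoSizes.isStarOrEdge (h : HasTwoSizes G c k d) (hc : 4 ≤ c)
    (hn : c + 4 ≤ Fintype.card V) (htop : G ≠ ⊤) (hbot : G ≠ ⊥) :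
    IsStarOrEdge G ∨ IsStarOrEdge Gᶜ := by
  classical
  by_cases hd1 : d = 1
  · subst hd1
    have hadj := fun (x y w w' : V) h1 h2 h3 h4 h5 =>
      h.adj_or_adj hc hn (x := x) (y := y) (w := w) (w' := w') h1 h2 h3 h4 h5
    obtain ⟨k', h'⟩ := h.compl
    have hadj' := fun (x y w w' : V) h1 h2 h3 h4 h5 =>
      h'.adj_or_adj hc hn (x := x) (y := y) (w := w) (w' := w') h1 h2 h3 h4 h5
    obtain ⟨x⟩ : Nonempty V := Fintype.card_pos_iff.1 (by omega)
    by_cases hx : 4 ≤ G.degree x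
    · right; right
      refine h'.exists_eq_edge hc hn (by rwa [ne_eq, compl_eq_bot]) fun v p q hp hq => ?_
      rw [SimpleGraph.compl_adj] at hp hq
      exact eq_of_not_adj_of_four_le_card hadj (x := x) (N := G.neighborFinset x)
        (fun w hw => (G.mem_neighborFinset x w).1 hw) hx hp.1 hq.1 hp.2 hq.2
    · left; right
      refine h.exists_eq_edge hc hn hbot fun v p q hp hq => ?_
      have hx' : 4 ≤ (Gᶜ.neighborFinset x).card := by
        have := G.degree_compl x
        rw [SimpleGraph.card_neighborFinset_eq_degree]
        omega
      exact eq_of_not_adj_of_four_le_card hadj' (fun w hw => (Gᶜ.mem_neighborFinset x w).1 hw) hx'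
        hp.ne hq.ne (fun e => e.2 hp) (fun e => e.2 hq)
  · have hrect : ∀ x y w w' : V, x ≠ y → x ≠ w → x ≠ w' → y ≠ w → y ≠ w' → w ≠ w' →
        adjInt G x w - adjInt G y w - (adjInt G x w' - adjInt G y w') = 0 := by
      intro x y w w' _ hxw hxw' hyw hyw' _
      by_cases hd2 : d = 2
      · subst hd2
        rw [h.twins_of_two hc hn hxw hyw, h.twins_of_two hc hn hxw' hyw']
        ring
      · have hdvd := h.dvd_rectangle (by omega) (by omega) hxw hxw' hyw hyw'
        by_contra hne
        -- a nonzero second difference is at most `2` in absolute value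
        have h1 := Int.natAbs_dvd_natAbs.2 hdvd
        have h2 := Nat.le_of_dvd (Int.natAbs_pos.2 hne) h1
        have h3 : d ≠ 0 := by
          rintro rfl
          exact hne (zero_dvd_iff.1 (by simpa using hdvd))
        rcases adjInt_eq_zero_or_one G x w with h1 | h1 <;>
          rcases adjInt_eq_zero_or_one G y w with h2 | h2 <;>
          rcases adjInt_eq_zero_or_one G x w' with h3 | h3 <;>
          rcases adjInt_eq_zero_or_one G y w' with h4 | h4 <;> simp_all <;> omega
    rcases eq_of_rectangle_eq_zero (by omega) hrect with h1 | h1 | h1 | h1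
    · exact absurd h1 htop
    · exact absurd h1 hbot
    · exact Or.inl (Or.inl h1)
    · exact Or.inr (Or.inl h1)

/-- Stars and single edges do have two sizes of induced subgraphs of order `c`. -/
theorem IsStarOrEdge.hasTwoSizes (h : IsStarOrEdge G) : ∃ k d, HasTwoSizes G c k d := by
  classical
  rcases h with ⟨r, rfl⟩ | ⟨a, b, hab, rfl⟩
  · refine ⟨0, c - 1, fun U hU => ?_⟩
    have h0 : ∀ W : Finset V, r ∉ W → size (SimpleGraph.starGraph r) W = 0 := by
      intro W hW
      rw [size_eq_card_filter, Finset.card_eq_zero, Finset.filter_eq_empty_iff]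
      intro e he hsub
      induction e with | _ p q
      rw [SimpleGraph.mem_edgeFinset, SimpleGraph.mem_edgeSet, SimpleGraph.starGraph_adj] at he
      rcases he.2 with rfl | rfl
      · exact hW (hsub (by simp))
      · exact hW (hsub (by simp))
    by_cases hr : r ∈ U
    · right
      have h1 := size_insert (SimpleGraph.starGraph r) (Finset.notMem_erase r U)
      rw [Finset.insert_erase hr, h0 _ (Finset.notMem_erase r U), Finset.filter_true_of_mem,
        Finset.card_erase_of_mem hr, hU] at h1
      · exact h1
      · intro w hw
        rw [SimpleGraph.starGraph_adj]
        exact ⟨(Finset.ne_of_mem_erase hw).symm, Or.inl rfl⟩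
    · exact Or.inl (h0 U hr)
  · refine ⟨0, 1, fun U _ => ?_⟩
    have : size (SimpleGraph.edge a b) U ≤ 1 := by
      rw [size_eq_card_filter, Finset.card_le_one]
      intro e he f hf
      simp only [Finset.mem_filter, SimpleGraph.mem_edgeFinset,
        SimpleGraph.edgeSet_edge_of_ne hab, Set.mem_singleton_iff] at he hf
      rw [he.1, hf.1]
    omega

end TwoSizes

/-! ### The first two moments and the range of the sizes -/

section Moments

theorem expect_mul_eq {ι : Type*} {s : Finset ι} (hs : s.Nonempty) (f : ι → ℝ) (l u : ℝ) :
    𝔼 i ∈ s, (f i - l) * (u - f i) =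
      (l + u) * 𝔼 i ∈ s, f i - 𝔼 i ∈ s, f i ^ 2 - l * u := by
  have h : ∀ i ∈ s, (f i - l) * (u - f i) = (l + u) * f i - f i ^ 2 - l * u := fun i _ => by ring
  rw [Finset.expect_congr rfl h, Finset.expect_sub_distrib, Finset.expect_sub_distrib,
    Finset.expect_const hs, ← Finset.mul_expect]

/-- A random variable with values between `l` and `u` satisfies `E[(X - l) (u - X)] ≥ 0`. -/
theorem expect_sq_le {ι : Type*} {s : Finset ι} (hs : s.Nonempty) {f : ι → ℝ} {l u : ℝ}
    (hl : ∀ i ∈ s, l ≤ f i) (hu : ∀ i ∈ s, f i ≤ u) :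
    𝔼 i ∈ s, f i ^ 2 ≤ (l + u) * 𝔼 i ∈ s, f i - l * u := by
  have h1 := expect_mul_eq hs f l u
  have h2 : 0 ≤ 𝔼 i ∈ s, (f i - l) * (u - f i) := Finset.expect_nonneg fun i hi =>
    mul_nonneg (sub_nonneg.2 (hl i hi)) (sub_nonneg.2 (hu i hi))
  linarith

theorem expect_sq_eq_iff {ι : Type*} {s : Finset ι} (hs : s.Nonempty) {f : ι → ℝ} {l u : ℝ}
    (hl : ∀ i ∈ s, l ≤ f i) (hu : ∀ i ∈ s, f i ≤ u) :
    𝔼 i ∈ s, f i ^ 2 = (l + u) * 𝔼 i ∈ s, f i - l * u ↔ ∀ i ∈ s, f i = l ∨ f i = u := by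
  have h1 := expect_mul_eq hs f l u
  have h2 : 𝔼 i ∈ s, (f i - l) * (u - f i) = 0 ↔ ∀ i ∈ s, (f i - l) * (u - f i) = 0 :=
    Finset.expect_eq_zero_iff_of_nonneg fun i hi =>
      mul_nonneg (sub_nonneg.2 (hl i hi)) (sub_nonneg.2 (hu i hi))
  have h3 : (∀ i ∈ s, f i = l ∨ f i = u) ↔ ∀ i ∈ s, (f i - l) * (u - f i) = 0 := by
    refine forall₂_congr fun i _ => ?_
    rw [mul_eq_zero, sub_eq_zero, sub_eq_zero, eq_comm (a := u)]
  rw [h3, ← h2, h1]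
  constructor <;> intro h <;> linarith

variable {V : Type*} [Fintype V] (G : SimpleGraph V)

/-- The second moment `E[M_c ^ 2]` of the size of a random induced subgraph of order `c`. -/
noncomputable def secondMoment (c : ℕ) : ℝ :=
  𝔼 U ∈ Finset.powersetCard c (Finset.univ : Finset V), (size G U : ℝ) ^ 2

theorem two_mul_S2 (c : ℕ) : 2 * S2 G c = secondMoment G c - S1 G c := by
  rw [S2, secondMoment, S1, ← Finset.expect_sub_distrib, ← mul_assoc]
  norm_num
  exact Finset.expect_congr rfl fun U _ => by ring

/-- The common form of all the bounds: `E[M_c (M_c - t)] / E[M_c - t]`. -/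
noncomputable def momentRatio (c : ℕ) (t : ℝ) : ℝ :=
  (secondMoment G c - t * S1 G c) / (S1 G c - t)

theorem maxSizeBound_eq {c : ℕ} {l : ℤ} (h0 : 0 < S1 G c) (hl : l < S1 G c) :
    maxSizeBound G c l = max (momentRatio G c 0) (momentRatio G c l) := by
  have hl' : S1 G c - l ≠ 0 := (sub_pos.2 hl).ne'
  have h0' := h0.ne'
  rw [maxSizeBound, sigmaSq, two_mul_S2, momentRatio, momentRatio]
  congr 1
  · field_simp
    ring
  · field_simp
    ring

theorem minSizeBound_eq {c : ℕ} {u : ℤ} (hu : S1 G c < u) :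
    minSizeBound G c u = momentRatio G c u := by
  have hu' : (u : ℝ) - S1 G c ≠ 0 := (sub_pos.2 hu).ne'
  have hu'' : S1 G c - u ≠ 0 := (sub_neg.2 hu).ne
  rw [minSizeBound, sigmaSq, two_mul_S2, momentRatio, eq_div_iff hu'',
    ← neg_sub (u : ℝ) (S1 G c)]
  field_simp
  ring

variable {G} {c : ℕ}

theorem powersetCard_univ_nonempty (hc : c ≤ Fintype.card V) :
    (Finset.powersetCard c (Finset.univ : Finset V)).Nonempty :=
  Finset.powersetCard_nonempty.2 (by simpa using hc)

/-- The size of an induced subgraph of order `c` is not constant. -/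
theorem minSize_lt_maxSize (htop : G ≠ ⊤) (hbot : G ≠ ⊥) (hc : 4 ≤ c)
    (hn : c + 4 ≤ Fintype.card V) : minSize G c < maxSize G c := by
  by_contra! hle
  have h0 : HasTwoSizes G c (minSize G c) 0 := fun U hU =>
    Or.inl (le_antisymm ((size_le_maxSize G hU).trans hle) (minSize_le_size G hU))
  rcases eq_top_or_eq_bot_of_twins (by omega)
    (fun x y w hx hy => h0.twins_of_zero (by omega) (by omega) hx hy) with h | h
  · exact htop h
  · exact hbot h

theorem minSize_lt_S1 (hlt : minSize G c < maxSize G c) (hc : c ≤ Fintype.card V) :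
    (minSize G c : ℝ) < S1 G c := by
  obtain ⟨U, hU, hsize⟩ := exists_size_eq_maxSize G hc
  refine Finset.lt_expect (fun W hW => ?_) ⟨U, ?_, ?_⟩
  · exact_mod_cast minSize_le_size G (Finset.mem_powersetCard.1 hW).2
  · exact Finset.mem_powersetCard.2 ⟨Finset.subset_univ _, hU⟩
  · rw [hsize]; exact_mod_cast hlt

theorem S1_lt_maxSize (hlt : minSize G c < maxSize G c) (hc : c ≤ Fintype.card V) :
    S1 G c < maxSize G c := by
  obtain ⟨U, hU, hsize⟩ := exists_size_eq_minSize G hc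
  refine Finset.expect_lt (fun W hW => ?_) ⟨U, ?_, ?_⟩
  · exact_mod_cast size_le_maxSize G (Finset.mem_powersetCard.1 hW).2
  · exact Finset.mem_powersetCard.2 ⟨Finset.subset_univ _, hU⟩
  · rw [hsize]; exact_mod_cast hlt

/-- For a lower bound `t` of the sizes, the ratio is at most the maximum size. -/
theorem momentRatio_le_maxSize (hc : c ≤ Fintype.card V) {t : ℝ} (ht : t ≤ minSize G c)
    (htS : t < S1 G c) : momentRatio G c t ≤ maxSize G c := by
  rw [momentRatio, div_le_iff₀ (sub_pos.2 htS)]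
  have h1 : secondMoment G c ≤ (t + maxSize G c) * S1 G c - t * maxSize G c :=
    expect_sq_le (powersetCard_univ_nonempty hc)
      (fun U hU => ht.trans (by exact_mod_cast minSize_le_size G (Finset.mem_powersetCard.1 hU).2))
      (fun U hU => by exact_mod_cast size_le_maxSize G (Finset.mem_powersetCard.1 hU).2)
  linarith

/-- For an upper bound `t` of the sizes, the ratio is at least the minimum size. -/
theorem minSize_le_momentRatio (hc : c ≤ Fintype.card V) {t : ℝ} (ht : (maxSize G c : ℝ) ≤ t)
    (htS : S1 G c < t) : minSize G c ≤ momentRatio G c t := by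
  rw [momentRatio, le_div_iff_of_neg (sub_neg.2 htS)]
  have h1 : secondMoment G c ≤ (minSize G c + t) * S1 G c - minSize G c * t :=
    expect_sq_le (powersetCard_univ_nonempty hc)
      (fun U hU => by exact_mod_cast minSize_le_size G (Finset.mem_powersetCard.1 hU).2)
      (fun U hU => le_trans (by exact_mod_cast size_le_maxSize G (Finset.mem_powersetCard.1 hU).2)
        ht)
  linarith

theorem secondMoment_eq_iff (hc : c ≤ Fintype.card V) {t : ℝ} (ht : t ≤ minSize G c) :
    secondMoment G c = (t + maxSize G c) * S1 G c - t * maxSize G c ↔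
      ∀ U : Finset V, U.card = c → (size G U : ℝ) = t ∨ size G U = maxSize G c := by
  refine (expect_sq_eq_iff (powersetCard_univ_nonempty hc)
    (fun U hU => ht.trans (by exact_mod_cast minSize_le_size G (Finset.mem_powersetCard.1 hU).2))
    (fun U hU => by exact_mod_cast size_le_maxSize G (Finset.mem_powersetCard.1 hU).2)).trans ?_
  simp

/-- The ratio for `t ≤ ℓ(c)` is the maximum size only if there are at most two sizes, one of
which is `t`. -/
theorem momentRatio_eq_maxSize_iff (hc : c ≤ Fintype.card V) {t : ℝ} (ht : t ≤ minSize G c)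
    (htS : t < S1 G c) : maxSize G c = momentRatio G c t ↔
      ∀ U : Finset V, U.card = c → (size G U : ℝ) = t ∨ size G U = maxSize G c := by
  rw [← secondMoment_eq_iff hc ht, momentRatio, eq_div_iff (sub_pos.2 htS).ne']
  constructor <;> intro h <;> linarith

theorem minSize_eq_momentRatio_iff (hlt : minSize G c < maxSize G c) (hc : c ≤ Fintype.card V) :
    minSize G c = momentRatio G c (maxSize G c) ↔
      ∀ U : Finset V, U.card = c → (size G U : ℝ) = minSize G c ∨ size G U = maxSize G c := by
  rw [← secondMoment_eq_iff hc le_rfl, momentRatio,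
    eq_div_iff (sub_neg.2 (S1_lt_maxSize hlt hc)).ne]
  constructor <;> intro h <;> linarith

/-- The sizes are all extremal exactly for stars, single edges and their complements. -/
theorem forall_size_extremal_iff (htop : G ≠ ⊤) (hbot : G ≠ ⊥) (hc : 4 ≤ c)
    (hn : c + 4 ≤ Fintype.card V) :
    (∀ U : Finset V, U.card = c → (size G U : ℝ) = minSize G c ∨ size G U = maxSize G c) ↔
      IsStarOrEdge G ∨ IsStarOrEdge Gᶜ := by
  have hlt := minSize_lt_maxSize htop hbot hc hn
  constructor
  · intro h
    refine HasTwoSizes.isStarOrEdge (k := minSize G c) (d := maxSize G c - minSize G c)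
      (fun U hU => ?_) hc hn htop hbot
    have := h U hU
    rw [Nat.cast_inj] at this
    omega
  · intro h
    obtain ⟨k, d, hkd⟩ : ∃ k d, HasTwoSizes G c k d := by
      rcases h with h | h
      · exact h.hasTwoSizes
      · obtain ⟨k, d, hkd⟩ := h.hasTwoSizes (c := c)
        obtain ⟨k', h'⟩ := hkd.compl
        rw [compl_compl] at h'
        exact ⟨k', d, h'⟩
    obtain ⟨A, hA, hAs⟩ := exists_size_eq_minSize G (c := c) (by omega)
    obtain ⟨B, hB, hBs⟩ := exists_size_eq_maxSize G (c := c) (by omega)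
    intro U hU
    rw [Nat.cast_inj]
    have h1 := hkd U hU
    have h2 := hkd A hA
    have h3 := hkd B hB
    omega

theorem maxSize_eq_maxSizeBound_iff (htop : G ≠ ⊤) (hbot : G ≠ ⊥) (hc : 4 ≤ c)
    (hn : c + 4 ≤ Fintype.card V) :
    (maxSize G c : ℝ) = maxSizeBound G c (minSize G c : ℤ) ↔
      IsStarOrEdge G ∨ IsStarOrEdge Gᶜ := by
  have hcn : c ≤ Fintype.card V := by omega
  have hlt := minSize_lt_maxSize htop hbot hc hn
  have hmin := minSize_lt_S1 hlt hcn
  have h0 : (0 : ℝ) ≤ minSize G c := Nat.cast_nonneg _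
  have hS := h0.trans_lt hmin
  rw [← forall_size_extremal_iff htop hbot hc hn, maxSizeBound_eq G hS (by exact_mod_cast hmin),
    Int.cast_natCast]
  constructor
  · intro h
    rcases max_choice (momentRatio G c 0) (momentRatio G c (minSize G c)) with hm | hm <;>
      rw [hm] at h
    · -- all sizes are `0` or maximal, so the minimum size is `0`
      rw [momentRatio_eq_maxSize_iff hcn h0 hS] at h
      obtain ⟨A, hA, hAs⟩ := exists_size_eq_minSize G hcn
      intro U hU
      refine (h U hU).imp_left fun hU0 => ?_
      rcases h A hA with h1 | h1
      · rw [hU0, ← h1, hAs]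
      · omega
    · rwa [momentRatio_eq_maxSize_iff hcn le_rfl hmin] at h
  · intro h
    rw [← momentRatio_eq_maxSize_iff hcn le_rfl hmin] at h
    rw [← h, max_eq_right (momentRatio_le_maxSize hcn h0 hS)]

theorem minSize_eq_minSizeBound_iff (htop : G ≠ ⊤) (hbot : G ≠ ⊥) (hc : 4 ≤ c)
    (hn : c + 4 ≤ Fintype.card V) :
    (minSize G c : ℝ) = minSizeBound G c (maxSize G c : ℤ) ↔
      IsStarOrEdge G ∨ IsStarOrEdge Gᶜ := by
  have hcn : c ≤ Fintype.card V := by omega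
  have hlt := minSize_lt_maxSize htop hbot hc hn
  rw [← forall_size_extremal_iff htop hbot hc hn, ← minSize_eq_momentRatio_iff hlt hcn,
    minSizeBound_eq G (by exact_mod_cast S1_lt_maxSize hlt hcn), Int.cast_natCast]

/-- The first moment lies strictly between any integer bounds on the sizes. -/
theorem S1_bounds (htop : G ≠ ⊤) (hbot : G ≠ ⊥) (hc : 4 ≤ c) (hn : c + 4 ≤ Fintype.card V)
    {l u : ℤ} (hl : l ≤ minSize G c) (hu : (maxSize G c : ℤ) ≤ u) :
    0 < S1 G c ∧ (l : ℝ) < S1 G c ∧ S1 G c < u := by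
  have hcn : c ≤ Fintype.card V := by omega
  have hlt := minSize_lt_maxSize htop hbot hc hn
  have hmin := minSize_lt_S1 hlt hcn
  refine ⟨lt_of_le_of_lt (Nat.cast_nonneg _) hmin, lt_of_le_of_lt ?_ hmin,
    lt_of_lt_of_le (S1_lt_maxSize hlt hcn) ?_⟩
  · exact_mod_cast hl
  · exact_mod_cast hu

theorem exists_ceil_maxSizeBound_le (hcn : c ≤ Fintype.card V) {l : ℤ} (hl : l ≤ minSize G c)
    (h0 : 0 < S1 G c) (hlS : l < S1 G c) :
    ∃ U : Finset V, U.card = c ∧ ⌈maxSizeBound G c l⌉ ≤ (size G U : ℤ) := by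
  obtain ⟨U, hU, hs⟩ := exists_size_eq_maxSize G hcn
  refine ⟨U, hU, ?_⟩
  rw [hs, Int.ceil_le, maxSizeBound_eq G h0 hlS, Int.cast_natCast]
  exact max_le (momentRatio_le_maxSize hcn (Nat.cast_nonneg _) h0)
    (momentRatio_le_maxSize hcn (by exact_mod_cast hl) hlS)

theorem exists_le_floor_minSizeBound (hcn : c ≤ Fintype.card V) {u : ℤ}
    (hu : (maxSize G c : ℤ) ≤ u) (huS : S1 G c < u) :
    ∃ U : Finset V, U.card = c ∧ (size G U : ℤ) ≤ ⌊minSizeBound G c u⌋ := by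
  obtain ⟨U, hU, hs⟩ := exists_size_eq_minSize G hcn
  refine ⟨U, hU, ?_⟩
  rw [hs, Int.le_floor, minSizeBound_eq G huS, Int.cast_natCast]
  exact minSize_le_momentRatio hcn (by exact_mod_cast hu) huS

end Moments

/-! ### The moments in terms of the degrees -/

section DegreeFormula

theorem card_inter_le_one {V : Type*} [DecidableEq V] {e f : Sym2 V} (hne : e ≠ f) :
    (e.toFinset ∩ f.toFinset).card ≤ 1 := by
  rw [Finset.card_le_one]
  intro x hx y hy
  by_contra hxy
  simp only [Finset.mem_inter, Sym2.mem_toFinset] at hx hy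
  exact hne (((Sym2.mem_and_mem_iff hxy).1 ⟨hx.1, hy.1⟩).trans
    ((Sym2.mem_and_mem_iff hxy).1 ⟨hx.2, hy.2⟩).symm)

theorem choose_sub_div_choose {n c s : ℕ} (hs : s ≤ c) (hc : c ≤ n) :
    ((n - s).choose (c - s) : ℝ) / n.choose c = c.descFactorial s / n.descFactorial s := by
  have h1 : (n.choose c : ℝ) ≠ 0 := by exact_mod_cast (Nat.choose_pos hc).ne'
  have h2 : (n.descFactorial s : ℝ) ≠ 0 := by
    exact_mod_cast (Nat.descFactorial_pos.2 (hs.trans hc)).ne'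
  rw [div_eq_div_iff h1 h2]
  have h3 := Nat.choose_mul (n := n) hs
  rw [Nat.descFactorial_eq_factorial_mul_choose, Nat.descFactorial_eq_factorial_mul_choose]
  norm_cast
  calc (n - s).choose (c - s) * (s.factorial * n.choose s)
      = s.factorial * (n.choose s * (n - s).choose (c - s)) := by ring
    _ = s.factorial * c.choose s * n.choose c := by rw [← h3]; ring

variable {V : Type*} [Fintype V] [DecidableEq V] (G : SimpleGraph V) [DecidableRel G.Adj] {c : ℕ}

theorem card_filter_subset_powersetCard_univ {s : Finset V} (h : s.card ≤ c) :
    ((Finset.powersetCard c (Finset.univ : Finset V)).filter (s ⊆ ·)).card =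
      (Fintype.card V - s.card).choose (c - s.card) := by
  rw [Finset.card_filter_powersetCard_subset s Finset.univ c (Finset.subset_univ s) h,
    Finset.card_univ]

theorem sum_size_eq (hc : 2 ≤ c) :
    ∑ U ∈ Finset.powersetCard c (Finset.univ : Finset V), size G U =
      G.edgeFinset.card * (Fintype.card V - 2).choose (c - 2) := by
  simp_rw [size_eq_card_filter, Finset.card_filter]
  rw [Finset.sum_comm, ← smul_eq_mul, ← Finset.sum_const]
  refine Finset.sum_congr rfl fun e he => ?_
  have h2 : e.toFinset.card = 2 :=
    Sym2.card_toFinset_of_not_isDiag e (G.not_isDiag_of_mem_edgeFinset he)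
  rw [← Finset.card_filter, card_filter_subset_powersetCard_univ (by omega), h2]

/-- Ordered pairs of distinct edges, counted with the number of their common vertices. -/
theorem sum_card_inter_eq :
    ∑ p ∈ G.edgeFinset.offDiag, (p.1.toFinset ∩ p.2.toFinset).card =
      ∑ v, G.degree v * (G.degree v - 1) := by
  have h1 : ∀ p : Sym2 V × Sym2 V, (p.1.toFinset ∩ p.2.toFinset).card =
      ∑ v, if v ∈ p.1 ∧ v ∈ p.2 then 1 else 0 := by
    intro p
    rw [← Finset.card_filter]
    congr 1
    ext v
    simp
  simp_rw [h1]
  rw [Finset.sum_comm]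
  refine Finset.sum_congr rfl fun v _ => ?_
  rw [← Finset.card_filter, ← G.card_incidenceFinset_eq_degree v, Nat.mul_sub_one,
    ← Finset.offDiag_card]
  congr 1
  ext ⟨e, f⟩
  simp only [Finset.mem_filter, Finset.mem_offDiag, SimpleGraph.mem_edgeFinset,
    SimpleGraph.mem_incidenceFinset, SimpleGraph.incidenceSet, Set.mem_ofPred_eq]
  tauto

theorem sum_size_mul_eq (hc : 4 ≤ c) :
    ∑ U ∈ Finset.powersetCard c (Finset.univ : Finset V), (size G U : ℝ) * ((size G U : ℝ) - 1) =
      G.edgeFinset.card * ((G.edgeFinset.card : ℝ) - 1) * (Fintype.card V - 4).choose (c - 4) +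
      (∑ v, G.degree v * (G.degree v - 1) : ℕ) *
        (((Fintype.card V - 3).choose (c - 3) : ℝ) - (Fintype.card V - 4).choose (c - 4)) := by
  have h1 : ∀ U : Finset V, (size G U : ℝ) * ((size G U : ℝ) - 1) =
      ∑ p ∈ G.edgeFinset.offDiag, if p.1.toFinset ∪ p.2.toFinset ⊆ U then 1 else 0 := by
    intro U
    have : (G.edgeFinset.offDiag.filter fun p => p.1.toFinset ∪ p.2.toFinset ⊆ U) =
        (G.edgeFinset.filter fun e => e.toFinset ⊆ U).offDiag := by
      ext ⟨e, f⟩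
      simp only [Finset.mem_filter, Finset.mem_offDiag, Finset.union_subset_iff]
      tauto
    rw [← Finset.natCast_card_filter, this, Finset.offDiag_card, ← size_eq_card_filter,
      Nat.cast_sub (Nat.le_mul_self _)]
    push_cast
    ring
  have h2 : ∀ p ∈ G.edgeFinset.offDiag,
      (∑ U ∈ Finset.powersetCard c (Finset.univ : Finset V),
        if p.1.toFinset ∪ p.2.toFinset ⊆ U then (1 : ℝ) else 0) =
      (Fintype.card V - 4).choose (c - 4) + (p.1.toFinset ∩ p.2.toFinset).card *
        (((Fintype.card V - 3).choose (c - 3) : ℝ) - (Fintype.card V - 4).choose (c - 4)) := by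
    rintro ⟨e, f⟩ hp
    rw [Finset.mem_offDiag] at hp
    obtain ⟨he, hf, hne⟩ := hp
    dsimp only at he hf hne ⊢
    have he2 := G.not_isDiag_of_mem_edgeFinset he
    have c1 := Sym2.card_toFinset_of_not_isDiag e he2
    have c2 := Sym2.card_toFinset_of_not_isDiag f (G.not_isDiag_of_mem_edgeFinset hf)
    have c3 := Finset.card_union_add_card_inter e.toFinset f.toFinset
    have c4 := card_inter_le_one hne
    rw [← Finset.natCast_card_filter, card_filter_subset_powersetCard_univ (by omega)]
    obtain h0 | h0 : (e.toFinset ∩ f.toFinset).card = 0 ∨ (e.toFinset ∩ f.toFinset).card = 1 := by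
      omega
    · rw [h0, show (e.toFinset ∪ f.toFinset).card = 4 by omega]
      simp
    · rw [h0, show (e.toFinset ∪ f.toFinset).card = 3 by omega]
      simp
  simp_rw [h1]
  rw [Finset.sum_comm, Finset.sum_congr rfl h2, Finset.sum_add_distrib, Finset.sum_const,
    ← Finset.sum_mul, ← sum_card_inter_eq, Finset.offDiag_card, nsmul_eq_mul,
    Nat.cast_sub (Nat.le_mul_self _)]
  push_cast
  ring

theorem S1_eq_div {n : ℕ} (hn : Fintype.card V = n) (hc : 4 ≤ c) (hcn : c ≤ n) :
    S1 G c = (G.edgeFinset.card * c * (c - 1) : ℝ) / (n * (n - 1)) := by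
  have h1 := choose_sub_div_choose (show 2 ≤ c by omega) hcn
  have h2 : ((∑ U ∈ Finset.powersetCard c (Finset.univ : Finset V), size G U : ℕ) : ℝ) = _ :=
    congrArg _ (sum_size_eq G (c := c) (by omega))
  rw [S1, Finset.expect_eq_sum_div_card, Finset.card_powersetCard, Finset.card_univ,
    ← Nat.cast_sum, h2, hn, Nat.cast_mul, mul_div_assoc, h1]
  have e1 : ((c - 1 : ℕ) : ℝ) = c - 1 := by rw [Nat.cast_sub (by omega)]; simp
  have e2 : ((n - 1 : ℕ) : ℝ) = n - 1 := by rw [Nat.cast_sub (by omega)]; simp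
  simp only [Nat.descFactorial, Nat.cast_mul, e1, e2]
  simp
  ring

theorem two_mul_S2_eq_div {n : ℕ} (hn : Fintype.card V = n) (hc : 4 ≤ c) (hcn : c ≤ n) :
    2 * S2 G c = (c * (c - 1) * (c - 2) *
      ((∑ v, G.degree v * (G.degree v - 1) : ℕ) * (n - 3) +
        (G.edgeFinset.card * (G.edgeFinset.card - 1) -
          (∑ v, G.degree v * (G.degree v - 1) : ℕ)) * (c - 3)) : ℝ) /
      (n * (n - 1) * (n - 2) * (n - 3)) := by
  have h3 := choose_sub_div_choose (show 3 ≤ c by omega) hcn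
  have h4 := choose_sub_div_choose (show 4 ≤ c by omega) hcn
  have hn4 : (4 : ℝ) ≤ n := by exact_mod_cast hc.trans hcn
  have hn0 : (n : ℝ) ≠ 0 := by linarith
  have hn1 : (n : ℝ) - 1 ≠ 0 := by linarith
  have hn2 : (n : ℝ) - 2 ≠ 0 := by linarith
  have hn3 : (n : ℝ) - 3 ≠ 0 := by linarith
  have e1 : ((c - 1 : ℕ) : ℝ) = c - 1 := by rw [Nat.cast_sub (by omega)]; simp
  have e2 : ((c - 2 : ℕ) : ℝ) = c - 2 := by rw [Nat.cast_sub (by omega)]; simp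
  have e3 : ((c - 3 : ℕ) : ℝ) = c - 3 := by rw [Nat.cast_sub (by omega)]; simp
  have f1 : ((n - 1 : ℕ) : ℝ) = n - 1 := by rw [Nat.cast_sub (by omega)]; simp
  have f2 : ((n - 2 : ℕ) : ℝ) = n - 2 := by rw [Nat.cast_sub (by omega)]; simp
  have f3 : ((n - 3 : ℕ) : ℝ) = n - 3 := by rw [Nat.cast_sub (by omega)]; simp
  rw [S2, Finset.expect_eq_sum_div_card, Finset.card_powersetCard, Finset.card_univ,
    sum_size_mul_eq G hc, hn, add_div, mul_div_assoc, h4, mul_div_assoc, sub_div, h3, h4]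
  simp only [Nat.descFactorial, Nat.cast_mul, e1, e2, e3, f1, f2, f3, Nat.sub_zero, Nat.cast_one]
  field_simp
  ring

end DegreeFormula

/-! ### Runs of the random access machine -/

section Machine

theorem run_add (P : List Instr) (a b : ℕ) (s : Config) :
    run P (a + b) s = run P b (run P a s) := by
  rw [run, run, run, Nat.add_comm, Function.iterate_add_apply]

theorem WordsBounded.mono {s : Config} {B B' : ℕ} (h : WordsBounded s B) (hB : B ≤ B') :
    WordsBounded s B' :=
  ⟨fun i => (h.1 i).trans hB, fun i => (h.2 i).trans hB⟩

theorem WordsBounded.write {s : Config} {B : ℕ} (h : WordsBounded s B) {x : ℤ} (d : ℕ)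
    (hx : x.natAbs ≤ B) : WordsBounded (s.write d x) B := by
  refine ⟨fun i => ?_, h.2⟩
  simp only [Config.write, Function.update_apply]
  split_ifs
  · exact hx
  · exact h.1 i

/-- In one step the exponent of a bound on the words at most doubles. -/
theorem WordsBounded.step {P : List Instr} (hP : ∀ d k, Instr.const d k ∈ P → k.natAbs ≤ 1)
    {R e : ℕ} (hR : 2 ≤ R) (he : 1 ≤ e) {s : Config} (h : WordsBounded s (R ^ e)) :
    WordsBounded (step P s) (R ^ (2 * e)) := by
  have hpow : R ^ (2 * e) = R ^ e * R ^ e := by rw [two_mul, pow_add]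
  have h2 : 2 ≤ R ^ e := hR.trans (Nat.le_self_pow (by omega) R)
  have hle : R ^ e ≤ R ^ (2 * e) := by rw [hpow]; nlinarith
  have hadd : R ^ e + R ^ e ≤ R ^ (2 * e) := by rw [hpow]; nlinarith
  have h' := h.mono hle
  rw [InducedSizes.step]
  split
  case h_2 => exact h'
  case h_1 i hi =>
    cases i with
    | const d k => exact h'.write d ((hP d k (List.mem_of_getElem? hi)).trans (by omega))
    | add d a b =>
      exact h'.write d ((Int.natAbs_add_le _ _).trans
        ((Nat.add_le_add (h.1 a) (h.1 b)).trans hadd))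
    | sub d a b =>
      exact h'.write d ((Int.natAbs_sub_le _ _).trans
        ((Nat.add_le_add (h.1 a) (h.1 b)).trans hadd))
    | mul d a b =>
      refine h'.write d ?_
      rw [Int.natAbs_mul, hpow]
      exact Nat.mul_le_mul (h.1 a) (h.1 b)
    | div d a b => exact h'.write d ((Int.natAbs_ediv_le_natAbs _ _).trans (h'.1 a))
    | load d a => exact h'.write d (h'.2 _)
    | store a i =>
      refine ⟨h'.1, fun j => ?_⟩
      simp only [Instr.exec, Function.update_apply]
      split_ifs
      · exact h'.1 i
      · exact h'.2 j
    | jpos r t => exact h'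

theorem WordsBounded.run {P : List Instr} (hP : ∀ d k, Instr.const d k ∈ P → k.natAbs ≤ 1)
    {R e : ℕ} (hR : 2 ≤ R) (he : 1 ≤ e) {s : Config} (h : WordsBounded s (R ^ e)) {t t₀ : ℕ}
    (ht : t ≤ t₀) : WordsBounded (run P t s) (R ^ (2 ^ t₀ * e)) := by
  have key : WordsBounded (InducedSizes.run P t s) (R ^ (2 ^ t * e)) := by
    clear ht
    induction t with
    | zero => simpa [InducedSizes.run] using h
    | succ t ih =>
      rw [InducedSizes.run, Function.iterate_succ_apply']
      have := ih.step hP hR (Nat.mul_pos (by positivity) he)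
      rwa [← mul_assoc, ← pow_succ'] at this
  exact key.mono (Nat.pow_le_pow_right (by omega)
    (Nat.mul_le_mul_right _ (Nat.pow_le_pow_right (by omega) ht)))

/-- The program for the two bounds. The loop at the instructions `2, …, 10` reads the `2 m`
end-points of the edges, keeps the current degree of the vertex `v` at the address `2 m + v`, and
adds the degree of each end-point before its update to register `6`, which ends as the number of
pairs of adjacent edges. The instructions `11, …, 33` compute the two moments over a common denominator, and
the others divide. -/
def boundProgram : List Instr :=
  [.const 7 1, .add 8 4 4,
    .load 10 5, .add 10 10 8, .load 11 10, .add 6 6 11, .add 11 11 7, .store 10 11, .add 5 5 7,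
    .sub 9 8 5, .jpos 9 2,
    .sub 9 1 7, .mul 10 1 9, .mul 11 4 10, .sub 9 9 7, .mul 10 10 9, .sub 9 9 7,
    .sub 12 0 7, .mul 13 0 12, .sub 12 12 7, .mul 14 13 12, .sub 12 12 7, .mul 14 14 12,
    .add 6 6 6, .mul 12 6 12, .sub 8 4 7, .mul 8 4 8, .sub 8 8 6, .mul 8 8 9, .add 12 12 8,
    .mul 12 10 12, .mul 12 12 13, .mul 15 11 14, .add 12 12 15,
    .sub 0 16 12, .div 0 0 15, .sub 0 16 0,
    .mul 8 2 15, .sub 8 8 12, .mul 9 2 13, .sub 9 11 9, .mul 9 14 9, .div 8 8 9, .sub 8 16 8,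
    .mul 1 3 15, .sub 1 1 12, .mul 9 3 13, .sub 9 9 11, .mul 9 14 9, .div 1 1 9,
    .sub 9 0 8, .jpos 9 53, .add 0 8 16]

theorem boundProgram_const (d : ℕ) (k : ℤ) (h : Instr.const d k ∈ boundProgram) :
    k.natAbs ≤ 1 := by
  simp [boundProgram] at h
  simp [h]

theorem run_boundProgram_start (r μ : ℕ → ℤ) :
    run boundProgram 2 ⟨0, r, μ⟩ =
      ⟨2, Function.update (Function.update r 7 1) 8 (r 4 + r 4), μ⟩ := rfl

theorem run_boundProgram_loop (r μ : ℕ → ℤ) :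
    ∃ r' : ℕ → ℤ, run boundProgram 9 ⟨2, r, μ⟩ =
      ⟨if 0 < r 8 - (r 5 + r 7) then 2 else 11, r',
        Function.update μ (μ (r 5).toNat + r 8).toNat (μ (μ (r 5).toNat + r 8).toNat + r 7)⟩ ∧
      r' 5 = r 5 + r 7 ∧ r' 6 = r 6 + μ (μ (r 5).toNat + r 8).toNat ∧
      r' 9 = r 8 - (r 5 + r 7) ∧ r' 10 = μ (r 5).toNat + r 8 ∧
      r' 11 = μ (μ (r 5).toNat + r 8).toNat + r 7 ∧
      ∀ j, j ≠ 5 → j ≠ 6 → j ≠ 9 → j ≠ 10 → j ≠ 11 → r' j = r j := by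
  let v := μ (r 5).toNat
  let d := μ (v + r 8).toNat
  refine ⟨Function.update (Function.update (Function.update (Function.update (Function.update
    (Function.update (Function.update r 10 v) 10 (v + r 8)) 11 d) 6 (r 6 + d)) 11 (d + r 7))
    5 (r 5 + r 7)) 9 (r 8 - (r 5 + r 7)),
    rfl, rfl, rfl, rfl, rfl, rfl, fun j h5 h6 h9 h10 h11 => ?_⟩
  simp [h5, h6, h9, h10, h11]

theorem run_boundProgram_moments (r μ : ℕ → ℤ) :
    ∃ r' : ℕ → ℤ, run boundProgram 23 ⟨11, r, μ⟩ = ⟨34, r', μ⟩ ∧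
      r' 2 = r 2 ∧ r' 3 = r 3 ∧ r' 16 = r 16 ∧
      r' 11 = r 4 * (r 1 * (r 1 - r 7)) ∧
      r' 13 = r 0 * (r 0 - r 7) ∧
      r' 14 = r 0 * (r 0 - r 7) * (r 0 - r 7 - r 7) * (r 0 - r 7 - r 7 - r 7) ∧
      r' 15 = r' 11 * r' 14 ∧
      r' 12 = r 1 * (r 1 - r 7) * (r 1 - r 7 - r 7) *
        ((r 6 + r 6) * (r 0 - r 7 - r 7 - r 7) +
          (r 4 * (r 4 - r 7) - (r 6 + r 6)) * (r 1 - r 7 - r 7 - r 7)) * r' 13 + r' 15 := by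
  obtain ⟨a, ha, a0, a1, a2, a3, a4, a6, a7, a16, a9, a10, a11⟩ : ∃ a : ℕ → ℤ,
      run boundProgram 6 ⟨11, r, μ⟩ = ⟨17, a, μ⟩ ∧ a 0 = r 0 ∧ a 1 = r 1 ∧ a 2 = r 2 ∧ a 3 = r 3 ∧
      a 4 = r 4 ∧ a 6 = r 6 ∧ a 7 = r 7 ∧ a 16 = r 16 ∧ a 9 = r 1 - r 7 - r 7 - r 7 ∧
      a 10 = r 1 * (r 1 - r 7) * (r 1 - r 7 - r 7) ∧ a 11 = r 4 * (r 1 * (r 1 - r 7)) :=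
    ⟨_, rfl, rfl, rfl, rfl, rfl, rfl, rfl, rfl, rfl, rfl, rfl, rfl⟩
  obtain ⟨b, hb, b2, b3, b4, b6, b7, b9, b10, b11, b16, b12, b13, b14⟩ : ∃ b : ℕ → ℤ,
      run boundProgram 6 ⟨17, a, μ⟩ = ⟨23, b, μ⟩ ∧ b 2 = a 2 ∧ b 3 = a 3 ∧ b 4 = a 4 ∧ b 6 = a 6 ∧
      b 7 = a 7 ∧ b 9 = a 9 ∧ b 10 = a 10 ∧ b 11 = a 11 ∧ b 16 = a 16 ∧
      b 12 = a 0 - a 7 - a 7 - a 7 ∧ b 13 = a 0 * (a 0 - a 7) ∧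
      b 14 = a 0 * (a 0 - a 7) * (a 0 - a 7 - a 7) * (a 0 - a 7 - a 7 - a 7) :=
    ⟨_, rfl, rfl, rfl, rfl, rfl, rfl, rfl, rfl, rfl, rfl, rfl, rfl, rfl⟩
  obtain ⟨d, hd, d2, d3, d9, d10, d11, d13, d14, d16, d8, d12⟩ : ∃ d : ℕ → ℤ,
      run boundProgram 5 ⟨23, b, μ⟩ = ⟨28, d, μ⟩ ∧ d 2 = b 2 ∧ d 3 = b 3 ∧ d 9 = b 9 ∧ d 10 = b 10 ∧
      d 11 = b 11 ∧ d 13 = b 13 ∧ d 14 = b 14 ∧ d 16 = b 16 ∧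
      d 8 = b 4 * (b 4 - b 7) - (b 6 + b 6) ∧ d 12 = (b 6 + b 6) * b 12 :=
    ⟨_, rfl, rfl, rfl, rfl, rfl, rfl, rfl, rfl, rfl, rfl, rfl⟩
  obtain ⟨f, hf, f2, f3, f11, f13, f14, f16, f15, f12⟩ : ∃ f : ℕ → ℤ,
      run boundProgram 6 ⟨28, d, μ⟩ = ⟨34, f, μ⟩ ∧ f 2 = d 2 ∧ f 3 = d 3 ∧ f 11 = d 11 ∧
      f 13 = d 13 ∧ f 14 = d 14 ∧ f 16 = d 16 ∧ f 15 = d 11 * d 14 ∧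
      f 12 = d 10 * (d 12 + d 8 * d 9) * d 13 + d 11 * d 14 :=
    ⟨_, rfl, rfl, rfl, rfl, rfl, rfl, rfl, rfl, rfl⟩
  refine ⟨f, ?_, ?_⟩
  · rw [run_add boundProgram 6 17, ha, run_add boundProgram 6 11, hb, run_add boundProgram 5 6, hd,
      hf]
  · simp only [*, and_self]

theorem run_boundProgram_divide (r μ : ℕ → ℤ) (h16 : r 16 = 0) :
    Halted boundProgram (run boundProgram 19 ⟨34, r, μ⟩) ∧
      (run boundProgram 19 ⟨34, r, μ⟩).reg 0 =
        max (-(-r 12 / r 15)) (-((r 2 * r 15 - r 12) / (r 14 * (r 11 - r 2 * r 13)))) ∧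
      (run boundProgram 19 ⟨34, r, μ⟩).reg 1 =
        (r 3 * r 15 - r 12) / (r 14 * (r 3 * r 13 - r 11)) := by
  obtain ⟨a, ha, a0, a2, a3, a8, a11, a12, a13, a14, a15, a16⟩ : ∃ a : ℕ → ℤ,
      run boundProgram 5 ⟨34, r, μ⟩ = ⟨39, a, μ⟩ ∧ a 0 = r 16 - (r 16 - r 12) / r 15 ∧ a 2 = r 2 ∧
      a 3 = r 3 ∧ a 8 = r 2 * r 15 - r 12 ∧ a 11 = r 11 ∧ a 12 = r 12 ∧ a 13 = r 13 ∧
      a 14 = r 14 ∧ a 15 = r 15 ∧ a 16 = r 16 :=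
    ⟨_, rfl, rfl, rfl, rfl, rfl, rfl, rfl, rfl, rfl, rfl, rfl⟩
  obtain ⟨b, hb, b0, b3, b8, b11, b12, b13, b14, b15, b16⟩ : ∃ b : ℕ → ℤ,
      run boundProgram 5 ⟨39, a, μ⟩ = ⟨44, b, μ⟩ ∧ b 0 = a 0 ∧ b 3 = a 3 ∧
      b 8 = a 16 - a 8 / (a 14 * (a 11 - a 2 * a 13)) ∧ b 11 = a 11 ∧ b 12 = a 12 ∧ b 13 = a 13 ∧
      b 14 = a 14 ∧ b 15 = a 15 ∧ b 16 = a 16 :=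
    ⟨_, rfl, rfl, rfl, rfl, rfl, rfl, rfl, rfl, rfl, rfl⟩
  obtain ⟨d, hd, d0, d8, d9, d1, d16⟩ : ∃ d : ℕ → ℤ,
      run boundProgram 7 ⟨44, b, μ⟩ = ⟨51, d, μ⟩ ∧ d 0 = b 0 ∧ d 8 = b 8 ∧ d 9 = b 0 - b 8 ∧
      d 1 = (b 3 * b 15 - b 12) / (b 14 * (b 3 * b 13 - b 11)) ∧ d 16 = b 16 :=
    ⟨_, rfl, rfl, rfl, rfl, rfl, rfl⟩
  obtain ⟨r', h, h0, h8, h9, h1, h16'⟩ : ∃ r' : ℕ → ℤ,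
      run boundProgram 17 ⟨34, r, μ⟩ = ⟨51, r', μ⟩ ∧
      r' 0 = r 16 - (r 16 - r 12) / r 15 ∧
      r' 8 = r 16 - (r 2 * r 15 - r 12) / (r 14 * (r 11 - r 2 * r 13)) ∧
      r' 9 = r' 0 - r' 8 ∧
      r' 1 = (r 3 * r 15 - r 12) / (r 14 * (r 3 * r 13 - r 11)) ∧ r' 16 = r 16 := by
    refine ⟨d, ?_, ?_⟩
    · rw [run_add boundProgram 5 12, ha, run_add boundProgram 5 7, hb, hd]
    · simp only [*, and_self]
  rw [h16, zero_sub, zero_sub] at h0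
  rw [h16, zero_sub] at h8
  rw [run_add boundProgram 17 2, h, ← h0, ← h8, ← h1]
  by_cases hpos : 0 < r' 9
  · have hrun : run boundProgram 2 ⟨51, r', μ⟩ = ⟨53, r', μ⟩ := by
      have h1 : run boundProgram 1 ⟨51, r', μ⟩ = ⟨53, r', μ⟩ := by
        change (⟨if 0 < r' 9 then 53 else 52, r', μ⟩ : Config) = _
        rw [if_pos hpos]
      rw [run_add boundProgram 1 1, h1]
      rfl
    rw [hrun]
    exact ⟨le_refl 53, (max_eq_left (by dsimp only; omega)).symm, rfl⟩
  · have hrun : run boundProgram 2 ⟨51, r', μ⟩ =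
        ⟨53, Function.update r' 0 (r' 8 + r' 16), μ⟩ := by
      have h1 : run boundProgram 1 ⟨51, r', μ⟩ = ⟨52, r', μ⟩ := by
        change (⟨if 0 < r' 9 then 53 else 52, r', μ⟩ : Config) = _
        rw [if_neg hpos]
      rw [run_add boundProgram 1 1, h1]
      rfl
    rw [hrun]
    refine ⟨le_refl 53, ?_, rfl⟩
    rw [max_eq_right (by omega)]
    dsimp only
    rw [Function.update_self, h16', h16, add_zero]

/-- The number of pairs of positions of `l` with equal entries below `n`. -/
def repeatCount (n : ℕ) (l : List ℕ) : ℕ := ∑ v ∈ Finset.range n, (l.count v).choose 2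

theorem repeatCount_append_singleton {n a : ℕ} (ha : a < n) (l : List ℕ) :
    repeatCount n (l ++ [a]) = repeatCount n l + l.count a := by
  have h : ∀ v, ((l ++ [a]).count v).choose 2 =
      (l.count v).choose 2 + if v = a then l.count a else 0 := by
    intro v
    by_cases hv : v = a
    · subst hv
      rw [List.count_append, List.count_singleton_self, if_pos rfl, Nat.choose_succ_succ',
        Nat.choose_one_right, Nat.add_comm]
    · rw [List.count_append, List.count_singleton, if_neg hv]
      simp [Ne.symm hv]
  rw [repeatCount, Finset.sum_congr rfl fun v _ => h v, Finset.sum_add_distrib,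
    Finset.sum_ite_eq' (Finset.range n) a, if_pos (Finset.mem_range.2 ha), repeatCount]

/-- The state of the machine after `i` rounds of the loop on the input words `ws`: register `6`
counts the pairs of equal entries among the first `i` words, and the memory behind the input holds
the multiplicities of these words. The registers `9, 10, 11` hold intermediate results. -/
structure LoopInv (n c m : ℕ) (l u : ℤ) (ws : List ℕ) (i : ℕ) (r μ : ℕ → ℤ) : Prop where
  reg0 : r 0 = n
  reg1 : r 1 = c
  reg2 : r 2 = l
  reg3 : r 3 = u
  reg4 : r 4 = m
  reg5 : r 5 = i
  reg6 : r 6 = repeatCount n (ws.take i)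
  reg7 : r 7 = 1
  reg8 : r 8 = ws.length
  reg9 : (r 9).natAbs ≤ ws.length + n
  reg10 : (r 10).natAbs ≤ ws.length + n
  reg11 : (r 11).natAbs ≤ ws.length + n
  reg_high : ∀ j, 12 ≤ j → r j = 0
  mem_low : ∀ j (h : j < ws.length), μ j = ws[j]
  mem_high : ∀ j, μ (ws.length + j) = (ws.take i).count j

theorem LoopInv.round {n c m : ℕ} {l u : ℤ} {ws : List ℕ} (hws : ∀ w ∈ ws, w < n) {i : ℕ}
    (hi : i < ws.length) {r μ : ℕ → ℤ} (h : LoopInv n c m l u ws i r μ) :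
    ∃ r' μ', run boundProgram 9 ⟨2, r, μ⟩ = ⟨if i + 1 < ws.length then 2 else 11, r', μ'⟩ ∧
      LoopInv n c m l u ws (i + 1) r' μ' := by
  obtain ⟨r', hrun, h5, h6, h9, h10, h11, hr⟩ := run_boundProgram_loop r μ
  have hv : μ (r 5).toNat = (ws[i] : ℕ) := by
    rw [h.reg5, Int.toNat_natCast, h.mem_low i hi]
  have haddr : (μ (r 5).toNat + r 8).toNat = ws.length + ws[i] := by
    rw [hv, h.reg8]; omega
  have hd : μ (μ (r 5).toNat + r 8).toNat = ((ws.take i).count ws[i] : ℕ) := by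
    rw [haddr, h.mem_high]
  have hlt : ws[i] < n := hws _ (List.getElem_mem hi)
  have htake : ws.take (i + 1) = ws.take i ++ [ws[i]] := by simp
  have hcount : (ws.take i).count ws[i] ≤ i := List.count_le_length.trans (by simp)
  rw [hd, h.reg7] at h11
  rw [hd, h.reg6] at h6
  rw [hv, h.reg8] at h10
  rw [h.reg8, h.reg5, h.reg7] at h9
  rw [h.reg5, h.reg7] at h5
  have hpc : (if 0 < r 8 - (r 5 + r 7) then 2 else 11) = if i + 1 < ws.length then 2 else 11 := by
    rw [h.reg8, h.reg5, h.reg7]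
    congr 1
    exact propext ⟨fun _ => by omega, fun _ => by omega⟩
  rw [hpc, hd, haddr, h.reg7] at hrun
  refine ⟨r', _, hrun, ?_⟩
  exact
    { reg0 := (hr 0 (by simp) (by simp) (by simp) (by simp) (by simp)).trans h.reg0
      reg1 := (hr 1 (by simp) (by simp) (by simp) (by simp) (by simp)).trans h.reg1
      reg2 := (hr 2 (by simp) (by simp) (by simp) (by simp) (by simp)).trans h.reg2
      reg3 := (hr 3 (by simp) (by simp) (by simp) (by simp) (by simp)).trans h.reg3
      reg4 := (hr 4 (by simp) (by simp) (by simp) (by simp) (by simp)).trans h.reg4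
      reg5 := by rw [h5]; push_cast; ring
      reg6 := by rw [h6, htake, repeatCount_append_singleton hlt]; push_cast; ring
      reg7 := (hr 7 (by simp) (by simp) (by simp) (by simp) (by simp)).trans h.reg7
      reg8 := (hr 8 (by simp) (by simp) (by simp) (by simp) (by simp)).trans h.reg8
      reg9 := by rw [h9]; omega
      reg10 := by rw [h10]; omega
      reg11 := by rw [h11]; omega
      reg_high := fun j hj => (hr j (by omega) (by omega) (by omega) (by omega) (by omega)).trans
        (h.reg_high j hj)
      mem_low := fun j hj => by
        rw [Function.update_of_ne (by omega)]
        exact h.mem_low j hj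
      mem_high := fun j => by
        rw [htake, List.count_append, List.count_singleton]
        by_cases hj : j = ws[i]
        · subst hj
          rw [Function.update_self]
          simp
        · rw [Function.update_of_ne (by omega), h.mem_high]
          simp [Ne.symm hj] }

end Machine

/-! ### Correctness of the program -/

section Correctness

theorem repeatCount_le (n : ℕ) (l : List ℕ) : repeatCount n l ≤ n * (l.length * l.length) := by
  calc repeatCount n l ≤ ∑ _v ∈ Finset.range n, l.length * l.length := by
        refine Finset.sum_le_sum fun v _ => ?_
        have h1 : l.count v ≤ l.length := List.count_le_length
        refine (Nat.choose_le_pow (l.count v) 2).trans ?_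
        rw [sq]
        exact Nat.mul_le_mul h1 h1
    _ = n * (l.length * l.length) := by simp

theorem LoopInv.wordsBounded {n c m : ℕ} {l u : ℤ} {ws : List ℕ} (hws : ∀ w ∈ ws, w < n)
    (hc : c ≤ n) (hm : m ≤ ws.length) (hlen : ws.length ≤ n ^ 2) {R : ℕ} (hR : 2 ≤ R) (hnR : n ≤ R)
    (hlR : l.natAbs ≤ R) (huR : u.natAbs ≤ R) {i : ℕ} (hi : i ≤ ws.length) {r μ : ℕ → ℤ}
    (h : LoopInv n c m l u ws i r μ) (pc : ℕ) : WordsBounded ⟨pc, r, μ⟩ (R ^ 5) := by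
  have hlR2 : ws.length ≤ R ^ 2 := hlen.trans (Nat.pow_le_pow_left hnR 2)
  have h15 : R ^ 1 ≤ R ^ 5 := Nat.pow_le_pow_right (by omega) (by omega)
  have h25 : R ^ 2 ≤ R ^ 5 := Nat.pow_le_pow_right (by omega) (by omega)
  have h35 : R ^ 3 ≤ R ^ 5 := Nat.pow_le_pow_right (by omega) (by omega)
  have hsum : ws.length + n ≤ R ^ 5 := by
    have : R ^ 2 + R ≤ R ^ 3 := by nlinarith
    omega
  have hrep : repeatCount n (ws.take i) ≤ R ^ 5 := by
    have h1 : (ws.take i).length ≤ R ^ 2 := (by simp : (ws.take i).length ≤ ws.length).trans hlR2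
    calc repeatCount n (ws.take i) ≤ n * ((ws.take i).length * (ws.take i).length) :=
          repeatCount_le n _
      _ ≤ R * (R ^ 2 * R ^ 2) := Nat.mul_le_mul hnR (Nat.mul_le_mul h1 h1)
      _ = R ^ 5 := by ring
  rw [pow_one] at h15
  constructor
  · intro j
    dsimp only
    by_cases hj : 12 ≤ j
    · rw [h.reg_high j hj]
      simp
    · interval_cases j
      · rw [h.reg0]; omega
      · rw [h.reg1]; omega
      · rw [h.reg2]; omega
      · rw [h.reg3]; omega
      · rw [h.reg4]; omega
      · rw [h.reg5]; omega
      · rw [h.reg6]; omega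
      · rw [h.reg7]; omega
      · rw [h.reg8]; omega
      · exact h.reg9.trans hsum
      · exact h.reg10.trans hsum
      · exact h.reg11.trans hsum
  · intro j
    dsimp only
    by_cases hj : j < ws.length
    · rw [h.mem_low j hj]
      have := hws _ (List.getElem_mem hj)
      omega
    · obtain ⟨k, rfl⟩ := Nat.exists_eq_add_of_le (not_lt.1 hj)
      rw [h.mem_high]
      have h1 : (ws.take i).count k ≤ (ws.take i).length := List.count_le_length
      have h2 : (ws.take i).length ≤ ws.length := by simp
      omega

/-- The words of the input encoding the edges. -/
def endpoints {n : ℕ} (L : List (Fin n × Fin n)) : List ℕ :=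
  L.flatMap fun p => [(p.1 : ℕ), (p.2 : ℕ)]

variable {n : ℕ}

theorem length_endpoints (L : List (Fin n × Fin n)) : (endpoints L).length = 2 * L.length := by
  induction L with
  | nil => rfl
  | cons p L ih =>
    rw [endpoints, List.flatMap_cons, List.length_append]
    rw [endpoints] at ih
    rw [ih, List.length_cons]
    simp
    ring

theorem lt_of_mem_endpoints {L : List (Fin n × Fin n)} {w : ℕ} (hw : w ∈ endpoints L) : w < n := by
  obtain ⟨p, -, hp⟩ := List.mem_flatMap.1 hw
  simp only [List.mem_cons, List.not_mem_nil, or_false] at hp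
  rcases hp with rfl | rfl
  · exact p.1.2
  · exact p.2.2

theorem initial_mem (c : ℕ) (l u : ℤ) (L : List (Fin n × Fin n)) (j : ℕ) :
    (initial n c l u L).mem j = ((endpoints L).getD j 0 : ℕ) := by
  have h : (L.flatMap fun p => [((p.1 : ℕ) : ℤ), ((p.2 : ℕ) : ℤ)]) =
      (endpoints L).map fun w : ℕ => (w : ℤ) := by
    rw [endpoints, List.map_flatMap]
    rfl
  change List.getD _ j 0 = _
  rw [h, List.getD_eq_getElem?_getD, List.getD_eq_getElem?_getD, List.getElem?_map]
  cases (endpoints L)[j]? <;> rfl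

theorem loopInv_start (c : ℕ) (l u : ℤ) (L : List (Fin n × Fin n)) :
    LoopInv n c L.length l u (endpoints L) 0
      (Function.update (Function.update (initial n c l u L).reg 7 1) 8
        ((initial n c l u L).reg 4 + (initial n c l u L).reg 4)) (initial n c l u L).mem where
  reg0 := rfl
  reg1 := rfl
  reg2 := rfl
  reg3 := rfl
  reg4 := rfl
  reg5 := rfl
  reg6 := by
    change (0 : ℤ) = _
    simp [repeatCount]
  reg7 := rfl
  reg8 := by
    rw [Function.update_self, length_endpoints]
    change (L.length : ℤ) + L.length = _
    push_cast
    ring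
  reg9 := Nat.zero_le _
  reg10 := Nat.zero_le _
  reg11 := Nat.zero_le _
  reg_high := fun j hj => by
    rw [Function.update_of_ne (by omega), Function.update_of_ne (by omega)]
    obtain ⟨k, rfl⟩ := Nat.exists_eq_add_of_le' hj
    rfl
  mem_low := fun j hj => by
    rw [initial_mem, List.getD_eq_getElem _ _ hj]
  mem_high := fun j => by
    rw [initial_mem, List.getD_eq_default _ _ (by omega)]
    simp

theorem run_boundProgram_rounds {c : ℕ} {l u : ℤ} {L : List (Fin n × Fin n)} (hL : 0 < L.length)
    {R : ℕ} (hR : 2 ≤ R) (hnR : n ≤ R) (hlR : l.natAbs ≤ R) (huR : u.natAbs ≤ R) (hc : c ≤ n)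
    (hlen : 2 * L.length ≤ n ^ 2) (i : ℕ) (hi : i ≤ (endpoints L).length) :
    ∃ r μ, run boundProgram (2 + 9 * i) (initial n c l u L) =
        ⟨if i < (endpoints L).length then 2 else 11, r, μ⟩ ∧
      LoopInv n c L.length l u (endpoints L) i r μ ∧
      ∀ t ≤ 2 + 9 * i, WordsBounded (run boundProgram t (initial n c l u L)) (R ^ (2 ^ 9 * 5)) := by
  have hlen2 := length_endpoints L
  have hbound := fun (i : ℕ) (hi : i ≤ (endpoints L).length) (r μ : ℕ → ℤ)
      (h : LoopInv n c L.length l u (endpoints L) i r μ) =>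
    h.wordsBounded (fun w => lt_of_mem_endpoints) hc (by omega) (by omega) hR hnR hlR huR hi
  induction i with
  | zero =>
    refine ⟨_, _, ?_, loopInv_start c l u L, ?_⟩
    · rw [if_pos (by omega)]
      exact run_boundProgram_start _ _
    · intro t ht
      refine WordsBounded.run boundProgram_const hR (by omega) ?_
        (ht.trans (by omega : 2 + 9 * 0 ≤ 9))
      have h0 := hbound 0 (by omega) _ _ (loopInv_start c l u L) 0
      refine ⟨fun j => ?_, h0.2⟩
      by_cases h7 : j = 7
      · subst h7
        exact Nat.zero_le _
      by_cases h8 : j = 8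
      · subst h8
        exact Nat.zero_le _
      have h1 := h0.1 j
      dsimp only at h1
      rwa [Function.update_of_ne h8, Function.update_of_ne h7] at h1
  | succ i ih =>
    obtain ⟨r, μ, hrun, hinv, hb⟩ := ih (by omega)
    rw [if_pos (by omega)] at hrun
    obtain ⟨r', μ', hrun', hinv'⟩ := hinv.round (fun w => lt_of_mem_endpoints) (by omega)
    refine ⟨r', μ', ?_, hinv', ?_⟩
    · rw [show 2 + 9 * (i + 1) = (2 + 9 * i) + 9 by ring, run_add, hrun, hrun']
    · intro t ht
      rcases le_total t (2 + 9 * i) with h | h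
      · exact hb t h
      · obtain ⟨k, rfl⟩ := Nat.exists_eq_add_of_le h
        rw [run_add, hrun]
        exact WordsBounded.run boundProgram_const hR (by omega)
          (hbound i (by omega) r μ hinv 2) (by omega)

/-- Once the loop has ended, the program computes the two integer expressions below. -/
theorem run_boundProgram {c : ℕ} {l u : ℤ} {L : List (Fin n × Fin n)} (hL : 0 < L.length)
    {R : ℕ} (hR : 2 ≤ R) (hnR : n ≤ R) (hlR : l.natAbs ≤ R) (huR : u.natAbs ≤ R) (hc : c ≤ n)
    (hlen : 2 * L.length ≤ n ^ 2) {A N₁ N₂ Z : ℤ}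
    (hA : A = L.length * (c * (c - 1))) (hN₁ : N₁ = n * (n - 1))
    (hN₂ : N₂ = n * (n - 1) * (n - 2) * (n - 3))
    (hZ : Z = c * (c - 1) * (c - 2) * (2 * repeatCount n (endpoints L) * (n - 3) +
      (L.length * (L.length - 1) - 2 * repeatCount n (endpoints L)) * (c - 3)) * N₁ + A * N₂) :
    ∃ T ≤ 62 * L.length, Halted boundProgram (run boundProgram T (initial n c l u L)) ∧
      (run boundProgram T (initial n c l u L)).reg 0 =
        max (-(-Z / (A * N₂))) (-((l * (A * N₂) - Z) / (N₂ * (A - l * N₁)))) ∧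
      (run boundProgram T (initial n c l u L)).reg 1 =
        (u * (A * N₂) - Z) / (N₂ * (u * N₁ - A)) ∧
      ∀ t ≤ T, WordsBounded (run boundProgram t (initial n c l u L)) (R ^ (2 ^ 42 * 5)) := by
  obtain ⟨r, μ, hrun, hinv, hb⟩ := run_boundProgram_rounds (l := l) (u := u) hL hR hnR hlR huR hc
    hlen (endpoints L).length le_rfl
  rw [if_neg (lt_irrefl _)] at hrun
  obtain ⟨r', hrun', h2, h3, h16, h11, h13, h14, h15, h12⟩ := run_boundProgram_moments r μ
  obtain ⟨hhalt, hr0, hr1⟩ := run_boundProgram_divide r' μ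
    (h16.trans (hinv.reg_high 16 (by omega)))
  have hT : run boundProgram (2 + 9 * (endpoints L).length + 23 + 19) (initial n c l u L) =
      run boundProgram 19 ⟨34, r', μ⟩ := by
    rw [run_add, run_add, hrun, hrun']
  have eA : r' 11 = A := by rw [h11, hinv.reg4, hinv.reg1, hinv.reg7, hA]
  have eN₁ : r' 13 = N₁ := by rw [h13, hinv.reg0, hinv.reg7, hN₁]
  have eN₂ : r' 14 = N₂ := by rw [h14, hinv.reg0, hinv.reg7, hN₂]; ring
  have eX : r' 15 = A * N₂ := by rw [h15, eA, eN₂]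
  have eZ : r' 12 = Z := by
    rw [h12, eN₁, eX, hinv.reg0, hinv.reg1, hinv.reg4, hinv.reg6, hinv.reg7, hZ, List.take_length]
    ring
  have hlen2 := length_endpoints L
  -- the input has `2 m` words, so these are `18 m + 44 ≤ 62 m` steps
  refine ⟨2 + 9 * (endpoints L).length + 23 + 19, by omega, by rwa [hT], ?_, ?_, ?_⟩
  · rw [hT, hr0, eX, eZ, eA, eN₁, eN₂, h2, hinv.reg2]
  · rw [hT, hr1, eX, eZ, eA, eN₁, eN₂, h3, hinv.reg3]
  · -- each of the at most `42` steps after the loop at most doubles the exponent, which starts at `5`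
    intro t ht
    rcases le_total t (2 + 9 * (endpoints L).length) with h | h
    · refine (hb t h).mono (Nat.pow_le_pow_right (by omega) ?_)
      exact Nat.mul_le_mul_right 5 (Nat.pow_le_pow_right (by omega) (by omega))
    · obtain ⟨k, rfl⟩ := Nat.exists_eq_add_of_le h
      rw [run_add, hrun]
      exact WordsBounded.run boundProgram_const hR (by omega)
        (hinv.wordsBounded (fun w => lt_of_mem_endpoints) hc (by omega) (by omega) hR hnR hlR huR
          le_rfl 11) (by omega)

/-! ### The output of the program -/

section Output

variable {G : SimpleGraph (Fin n)} {L : List (Fin n × Fin n)}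

theorem IsEdgeList.length_eq [DecidableRel G.Adj] (hL : IsEdgeList G L) :
    L.length = G.edgeFinset.card := by
  have h : (L.map fun p => s(p.1, p.2)).toFinset = G.edgeFinset := by
    ext e
    rw [List.mem_toFinset, hL.2, SimpleGraph.mem_edgeFinset]
  rw [← h, List.toFinset_card_of_nodup hL.1, List.length_map]

theorem IsEdgeList.count_eq_degree [DecidableRel G.Adj] (hL : IsEdgeList G L) (v : Fin n) :
    (endpoints L).count (v : ℕ) = G.degree v := by
  have h1 : ∀ p ∈ L, p.1 ≠ p.2 := by
    intro p hp
    have h2 := (hL.2 s(p.1, p.2)).1 (List.mem_map_of_mem hp)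
    exact (G.mem_edgeSet.1 h2).ne
  have h2 : ∀ L' : List (Fin n × Fin n), (∀ p ∈ L', p.1 ≠ p.2) →
      (endpoints L').count (v : ℕ) =
        ((L'.map fun p => s(p.1, p.2)).filter fun e => v ∈ e).length := by
    intro L' hL'
    induction L' with
    | nil => rfl
    | cons p L' ih =>
      have h3 := ih fun q hq => hL' q (List.mem_cons_of_mem p hq)
      have h4 := hL' p List.mem_cons_self
      rw [endpoints] at h3 ⊢
      rw [List.flatMap_cons, List.count_append, h3, List.map_cons, List.filter_cons]
      by_cases e1 : v = p.1
      · have e2 : v ≠ p.2 := fun e => h4 (e1.symm.trans e)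
        simp [e1, Fin.val_inj, Ne.symm h4, add_comm]
      · by_cases e2 : v = p.2
        · simp [e2, Fin.val_inj, h4, add_comm]
        · simp [Fin.val_inj, e1, e2, Ne.symm e1, Ne.symm e2]
  rw [h2 L h1, ← List.toFinset_card_of_nodup (hL.1.filter _), ← G.card_incidenceFinset_eq_degree v]
  congr 1
  ext e
  rw [List.mem_toFinset, List.mem_filter, hL.2, SimpleGraph.mem_incidenceFinset]
  simp [SimpleGraph.incidenceSet]

theorem IsEdgeList.two_mul_repeatCount [DecidableRel G.Adj] (hL : IsEdgeList G L) :
    2 * repeatCount n (endpoints L) = ∑ v, G.degree v * (G.degree v - 1) := by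
  rw [repeatCount, Finset.sum_range, Finset.mul_sum]
  refine Finset.sum_congr rfl fun v _ => ?_
  rw [hL.count_eq_degree, Nat.choose_two_right]
  exact Nat.mul_div_cancel' (Nat.even_mul_pred_self _).two_dvd

theorem floor_intCast_div (p : ℤ) {q : ℤ} (hq : 0 < q) : ⌊(p : ℝ) / q⌋ = p / q := by
  have hq' : (0 : ℝ) < q := by exact_mod_cast hq
  rw [Int.floor_eq_iff, le_div_iff₀ hq', div_lt_iff₀ hq']
  constructor
  · exact_mod_cast Int.ediv_mul_le p hq.ne'
  · exact_mod_cast Int.lt_ediv_add_one_mul_self p hq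

theorem ceil_intCast_div (p : ℤ) {q : ℤ} (hq : 0 < q) : ⌈(p : ℝ) / q⌉ = -(-p / q) := by
  rw [← floor_intCast_div (-p) hq, Int.cast_neg, neg_div, Int.floor_neg, neg_neg]

/-- Multiplying out the common denominator of the two moments. -/
theorem momentRatio_eq_div {V : Type*} [Fintype V] (G : SimpleGraph V) {c : ℕ}
    {A N₁ N₂ Z : ℝ} (hN₁ : N₁ ≠ 0) (hN₂ : N₂ ≠ 0) (h1 : S1 G c = A / N₁)
    (h2 : secondMoment G c = Z / (N₁ * N₂)) (t : ℝ) :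
    momentRatio G c t = (Z - t * (A * N₂)) / (N₂ * (A - t * N₁)) := by
  have e1 : secondMoment G c - t * S1 G c = (Z - t * (A * N₂)) / (N₁ * N₂) := by
    rw [h1, h2]; field_simp
  have e2 : S1 G c - t = N₂ * (A - t * N₁) / (N₁ * N₂) := by
    rw [h1]; field_simp
  rw [momentRatio, e1, e2, div_div_div_cancel_right₀ (mul_ne_zero hN₁ hN₂)]

theorem exists_run_boundProgram {c : ℕ} {l u : ℤ} (htop : G ≠ ⊤) (hbot : G ≠ ⊥) (hc : 4 ≤ c)
    (hn : c + 4 ≤ n) (hl : l ≤ minSize G c) (hu : (maxSize G c : ℤ) ≤ u) (hL : IsEdgeList G L) :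
    ∃ T ≤ 62 * G.edgeSet.ncard,
      Halted boundProgram (run boundProgram T (initial n c l u L)) ∧
      (run boundProgram T (initial n c l u L)).reg 0 = ⌈maxSizeBound G c l⌉ ∧
      (run boundProgram T (initial n c l u L)).reg 1 = ⌊minSizeBound G c u⌋ ∧
      ∀ t ≤ T, WordsBounded (run boundProgram t (initial n c l u L))
        ((n + l.natAbs + u.natAbs) ^ (2 ^ 42 * 5)) := by
  classical
  have hcard : Fintype.card (Fin n) = n := Fintype.card_fin n
  obtain ⟨hS0, hlS, hSu⟩ := S1_bounds htop hbot hc (by rwa [hcard]) hl hu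
  have hm := hL.length_eq
  have hncard : G.edgeSet.ncard = L.length := by
    rw [hm, ← SimpleGraph.coe_edgeFinset, Set.ncard_coe_finset]
  have hpos : 0 < L.length := by
    rw [hm, Finset.card_pos, SimpleGraph.edgeFinset_nonempty]
    exact hbot
  have hlen : 2 * L.length ≤ n ^ 2 := by
    have h1 := G.card_edgeFinset_le_card_choose_two
    rw [hcard, ← hm] at h1
    have h3 : n.choose 2 * 2 = n * (n - 1) := by
      rw [Nat.choose_two_right]
      exact Nat.div_mul_cancel (Nat.even_mul_pred_self n).two_dvd
    have h4 : n * (n - 1) ≤ n ^ 2 := by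
      rw [sq]
      exact Nat.mul_le_mul_left n (Nat.sub_le n 1)
    omega
  set A : ℤ := L.length * (c * (c - 1)) with hA
  set N₁ : ℤ := n * (n - 1) with hN₁
  set N₂ : ℤ := n * (n - 1) * (n - 2) * (n - 3) with hN₂
  set Z : ℤ := c * (c - 1) * (c - 2) * (2 * repeatCount n (endpoints L) * (n - 3) +
      (L.length * (L.length - 1) - 2 * repeatCount n (endpoints L)) * (c - 3)) * N₁ + A * N₂ with hZ
  obtain ⟨T, hT, hhalt, hr0, hr1, hb⟩ := run_boundProgram (l := l) (u := u) hpos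
    (R := n + l.natAbs + u.natAbs) (by omega) (by omega) (by omega) (by omega) (by omega) hlen
    hA hN₁ hN₂ hZ
  refine ⟨T, by rwa [hncard], hhalt, ?_, ?_, hb⟩
  all_goals
    have hn8 : (8 : ℤ) ≤ n := by omega
    have hN₁pos : 0 < N₁ := mul_pos (by omega) (by omega)
    have hN₂pos : 0 < N₂ := mul_pos (mul_pos (mul_pos (by omega) (by omega)) (by omega)) (by omega)
    have hApos : 0 < A := mul_pos (by omega) (mul_pos (by omega) (by omega))
    have hN₁R : (0 : ℝ) < N₁ := by exact_mod_cast hN₁pos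
    have hN₂R : (0 : ℝ) < N₂ := by exact_mod_cast hN₂pos
    have hS1 : S1 G c = (A : ℝ) / N₁ := by
      rw [S1_eq_div G hcard hc (by omega), ← hm, hA, hN₁]
      push_cast
      ring
    have hM2 : secondMoment G c = (Z : ℝ) / (N₁ * N₂) := by
      have h1 := two_mul_S2 G c
      have h2 := two_mul_S2_eq_div G hcard hc (by omega : c ≤ n)
      have h3 : secondMoment G c = 2 * S2 G c + S1 G c := by linarith
      rw [h3, h2, hS1, ← hL.two_mul_repeatCount, ← hm]
      have h4 : (n * (n - 1) * (n - 2) * (n - 3) : ℝ) = N₂ := by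
        rw [hN₂]; push_cast; ring
      rw [h4, div_add_div _ _ hN₂R.ne' hN₁R.ne', hZ, mul_comm (N₁ : ℝ)]
      push_cast
      ring
    have hratio := momentRatio_eq_div G hN₁R.ne' hN₂R.ne' hS1 hM2
  · have hAl : 0 < A - l * N₁ := by
      rw [hS1, lt_div_iff₀ hN₁R] at hlS
      have : l * N₁ < A := by exact_mod_cast hlS
      omega
    rw [hr0, maxSizeBound_eq G hS0 hlS, Int.ceil_mono.map_max]
    congr 1
    · rw [← ceil_intCast_div Z (mul_pos hApos hN₂pos), hratio]
      push_cast
      congr 2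
      · ring
      · ring
    · have h1 : l * (A * N₂) - Z = -(Z - l * (A * N₂)) := by ring
      rw [h1, ← ceil_intCast_div _ (mul_pos hN₂pos hAl), hratio]
      push_cast
      rfl
  · have hAu : 0 < u * N₁ - A := by
      rw [hS1, div_lt_iff₀ hN₁R] at hSu
      have : A < u * N₁ := by exact_mod_cast hSu
      omega
    rw [hr1, minSizeBound_eq G hSu, ← floor_intCast_div _ (mul_pos hN₂pos hAu), hratio,
      ← neg_div_neg_eq]
    push_cast
    congr 2
    · ring
    · ring

end Output

end Correctness

end InducedSizes

theorem theorem4p3 :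
    (∀ (V : Type*) [Fintype V] (G : SimpleGraph V) (c : ℕ),
      G ≠ ⊤ → G ≠ ⊥ → 4 ≤ c → c + 4 ≤ Fintype.card V →
        (∀ l u : ℤ, l ≤ (minSize G c : ℤ) → (maxSize G c : ℤ) ≤ u →
          (0 < S1 G c ∧ (l : ℝ) < S1 G c ∧ S1 G c < (u : ℝ)) ∧
          (∃ U : Finset V, U.card = c ∧ ⌈maxSizeBound G c l⌉ ≤ (size G U : ℤ)) ∧
          (∃ U : Finset V, U.card = c ∧ (size G U : ℤ) ≤ ⌊minSizeBound G c u⌋)) ∧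
        ((maxSize G c : ℝ) = maxSizeBound G c (minSize G c : ℤ) ↔
          IsStarOrEdge G ∨ IsStarOrEdge Gᶜ) ∧
        ((minSize G c : ℝ) = minSizeBound G c (maxSize G c : ℤ) ↔
          IsStarOrEdge G ∨ IsStarOrEdge Gᶜ) ∧
        maxSize G c ≤ gammaBound G c ∧
        (∀ a : ℤ, (G.indepNum : ℤ) ≤ a → (c : ℤ) - a ≤ (minSize G c : ℤ))) ∧
    (∃ (P : List Instr) (C K : ℕ),
      ∀ (n : ℕ) (G : SimpleGraph (Fin n)) (c : ℕ) (l u : ℤ) (L : List (Fin n × Fin n)),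
        G ≠ ⊤ → G ≠ ⊥ → 4 ≤ c → c + 4 ≤ n →
        l ≤ (minSize G c : ℤ) → (maxSize G c : ℤ) ≤ u → IsEdgeList G L →
          ∃ T ≤ C * G.edgeSet.ncard,
            Halted P (run P T (initial n c l u L)) ∧
            (run P T (initial n c l u L)).reg 0 = ⌈maxSizeBound G c l⌉ ∧
            (run P T (initial n c l u L)).reg 1 = ⌊minSizeBound G c u⌋ ∧
            ∀ t ≤ T, WordsBounded (run P t (initial n c l u L)) ((n + l.natAbs + u.natAbs) ^ K)) := by
  refine ⟨fun V _ G c htop hbot hc hn => ⟨fun l u hl hu => ?_,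
    maxSize_eq_maxSizeBound_iff htop hbot hc hn, minSize_eq_minSizeBound_iff htop hbot hc hn, ?_,
    fun a ha => ?_⟩, boundProgram, 62, 2 ^ 42 * 5, fun n G c l u L htop hbot hc hn hl hu hL =>
    exists_run_boundProgram htop hbot hc hn hl hu hL⟩
  · have hS := S1_bounds htop hbot hc hn hl hu
    exact ⟨hS, exists_ceil_maxSizeBound_le (by omega) hl hS.1 hS.2.1,
      exists_le_floor_minSizeBound (by omega) hu hS.2.2⟩
  · obtain ⟨U, hU, hs⟩ := exists_size_eq_maxSize G (c := c) (by omega)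
    rw [← hs, ← hU]
    exact size_le_gammaBound G U
  · obtain ⟨U, hU, hs⟩ := exists_size_eq_minSize G (c := c) (by omega)
    have h := card_le_indepNum_add_size G U
    rw [hU, hs] at h
    omega
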